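/- Let $\Omega\subset\mathbb C$ be either a set without accumulation points, with $\mu$ the counting measure on $\Omega$, or a finite union of disjoint oriented simple rectifiable contours, each of which is closed or extends to infinity in both directions, with $d\mu=dz$. Let $L^2(\Omega)$ denote $\ell^2(\Omega)$, respectively $L^2(\Omega,|dz|)$. Fix $m\ge 1$. For parameters $x,y,t\in\mathbb R^m$ put $m_j(z)=e^{t_jz^3+y_jz^2+x_jz}$ and $\Delta(z)=\operatorname{diag}(m_1(z),\dots,m_m(z),1)$, and let $E_i$ be the $(m+1)\times(m+1)$ matrix whose $(i,i)$ entry is $1$ and whose other entries are $0$. Let $U\subset\mathbb R^{3m}$ be open, and let $H=H_{(x,y,t)}$, $(x,y,t)\in U$, be a cubic integrable operator. That is, $H$ is a bounded integral operator on $L^2(\Omega)$ with kernel (with respect to $\mu$) $$H(u,v)=\frac{f(u)^Tg(v)}{u-v}\quad(u\ne v),\qquad H(u,u)=0,$$ where $f=\mathsf c\,\Delta\,\mathsf F$ and $g=\mathsf c^{-1}\Delta^{-1}\mathsf G$. Here $\mathsf F,\mathsf G:\Omega\to\mathbb C^{m+1}$ are measurable, independent of $(x,y,t)$, and satisfy $\mathsf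 F(u)^TE_j\mathsf G(u)=0$ for all $u\in\Omega$ and $1\le j\le m+1$; the function $\mathsf c:\Omega\to\mathbb C\setminus\{0\}$ is measurable and may depend on $(x,y,t)$; and $f,g\in L^2(\Omega)\cap L^\infty(\Omega)$. Assume that $H$ is trace class for all $(x,y,t)\in U$, and that on $U$ the functions $f,g$ depend continuously on $(x,y,t)$ in $L^2(\Omega)$ and $H$ depends continuously on $(x,y,t)$ in trace norm. Let $D(x,y,t)=\det(I-H)$ be the Fredholm determinant. Then, at every point $(x,y,t)\in U$ at which $I-H$ is invertible, with $$Y_1=\int_\Omega\big((I-H)^{-1}f\big)(s)\,g(s)^T\,d\mu(s),$$ one has $D\neq0$, the partial derivatives $\partial_{x_i}D$, $1\le i\le m$, exist, and $$\partial_{x_i}\log D=\frac{\partial_{x_i}D}{D}=-\operatorname{Tr}(Y_1E_i),\qquad i=1,\dots,m.$$ -/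

import Mathlib

open MeasureTheory Filter Topology
open scoped ENNReal

noncomputable section

/-! ### Trace class operators and Fredholm determinants on a complex Hilbert space -/

section TraceClass

variable {E : Type*} [NormedAddCommGroup E] [InnerProductSpace ℂ E]

/-- `T = ∑ₙ ⟨bₙ, ·⟩ aₙ` and `∑ₙ ‖aₙ‖ ‖bₙ‖ = r` (an absolutely convergent sum of operators of rank at
most one). -/
def IsNuclearRep (T : E →L[ℂ] E) (a b : ℕ → E) (r : ℝ) : Prop :=
  HasSum (fun n => ‖a n‖ * ‖b n‖) r ∧
    ∀ x : E, HasSum (fun n => inner ℂ (b n) x • a n) (T x)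

/-- Trace class operators on a Hilbert space: the operators that have a nuclear representation. -/
def IsTraceClass (T : E →L[ℂ] E) : Prop :=
  ∃ (a b : ℕ → E) (r : ℝ), IsNuclearRep T a b r

/-- The trace norm of a trace class operator on a Hilbert space (its nuclear norm). -/
def traceNorm (T : E →L[ℂ] E) : ℝ :=
  sInf {r : ℝ | ∃ a b : ℕ → E, IsNuclearRep T a b r}

/-- The Fredholm determinant `det (1 - T) = ∑ₖ (-1)ᵏ Tr (Λᵏ T)` of a trace class operator, where the
traces are computed in the Hilbert basis of `Λᵏ E` that the Hilbert basis `b` of `E` induces: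
`Tr (Λᵏ T) = ∑_{|S| = k} det (⟨bᵢ, T bⱼ⟩)_{i, j ∈ S}`. For trace class `T` the sum over all
finite `S` converges absolutely and does not depend on `b`. -/
def fredholmDet {ι : Type*} (b : HilbertBasis ι ℂ E) (T : E →L[ℂ] E) : ℂ :=
  ∑' S : Finset ι, (-1 : ℂ) ^ S.card *
    letI := Classical.decEq ι
    Matrix.det (Matrix.of fun i j : S => inner ℂ (b i) (T (b j)))

end TraceClass

/-! ### The sets `Ω` -/

/-- An oriented simple rectifiable contour in the complex plane, parametrized by arc length, that
either extends to infinity in both directions or is closed. -/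
structure SimpleContour where
  /-- the arc length parametrization -/
  γ : ℝ → ℂ
  /-- the interval that is mapped bijectively to the contour -/
  dom : Set ℝ
  lipschitz : LipschitzWith 1 γ
  unit_speed : ∀ᵐ s : ℝ, ‖deriv γ s‖ = 1
  injOn : Set.InjOn γ dom
  infinite_or_closed :
    (dom = Set.univ ∧ Tendsto γ (cocompact ℝ) (cocompact ℂ)) ∨
    (∃ L : ℝ, 0 < L ∧ dom = Set.Ico 0 L ∧ Function.Periodic γ L)

namespace SimpleContour

/-- The contour as a set of points. -/
def carrier (C : SimpleContour) : Set ℂ := C.γ '' C.dom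

/-- The arc length measure `|dz|`. -/
def arcLength (C : SimpleContour) : Measure ℂ := Measure.map C.γ (volume.restrict C.dom)

/-- The unit tangent `dz / |dz|` at the points of the contour, and `0` off the contour. -/
def tangent (C : SimpleContour) : ℂ → ℂ :=
  Function.extend (fun s : C.dom => C.γ s) (fun s : C.dom => deriv C.γ s) 0

end SimpleContour

/-- The sets `Ω`: either a subset of `ℂ` without accumulation points, or a finite union of disjoint
simple contours, each of which is closed or extends to infinity. -/
inductive SpectralSet
  | discrete (Ω : Set ℂ) (h : ∀ z : ℂ, ¬ AccPt z (𝓟 Ω))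
  | contours (n : ℕ) (C : Fin n → SimpleContour)
      (h : Pairwise fun k l => Disjoint (C k).carrier (C l).carrier)

namespace SpectralSet

/-- The set `Ω` itself. -/
def carrier : SpectralSet → Set ℂ
  | discrete Ω _ => Ω
  | contours _ C _ => ⋃ k, (C k).carrier

/-- The positive measure `|dμ|`: counting measure on `Ω`, respectively arc length `|dz|`. -/
def absMeasure : SpectralSet → Measure ℂ
  | discrete Ω _ => Measure.count.restrict Ω
  | contours _ C _ => ∑ k, (C k).arcLength

/-- The density `dμ / |dμ|`: one for a discrete set, the unit tangent `dz / |dz|` for contours. -/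
def density : SpectralSet → ℂ → ℂ
  | discrete _ _ => 1
  | contours _ C _ => ∑ k, (C k).tangent

/-- The integral `∫_Ω φ dμ`. -/
def integral (X : SpectralSet) (φ : ℂ → ℂ) : ℂ := ∫ u, φ u * X.density u ∂X.absMeasure

/-- The Hilbert space `L²(Ω)`, that is `ℓ²(Ω)` for a discrete set and `L²(Ω, |dz|)` for contours. -/
abbrev Hilb (X : SpectralSet) : Type := Lp ℂ 2 X.absMeasure

/-- `T` is the integral operator on `L²(Ω)` with kernel `k` with respect to `μ`. -/
def IsIntegralOperator (X : SpectralSet) (T : X.Hilb →L[ℂ] X.Hilb) (k : ℂ → ℂ → ℂ) : Prop :=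
  ∀ φ : X.Hilb, ∀ᵐ u ∂X.absMeasure,
    Integrable (fun v => k u v * φ v * X.density v) X.absMeasure ∧
      T φ u = X.integral fun v => k u v * φ v

end SpectralSet

/-! ### Cubic integrable operators -/

/-- The parameters `(x, y, t)`, each in `ℝᵐ`. -/
abbrev Params (m : ℕ) : Type := (Fin m → ℝ) × (Fin m → ℝ) × (Fin m → ℝ)

/-- The cubic exponential `exp (tⱼ z³ + yⱼ z² + xⱼ z)`. -/
def cubicExp {m : ℕ} (p : Params m) (j : Fin m) (z : ℂ) : ℂ :=
  Complex.exp (p.2.2 j * z ^ 3 + p.2.1 j * z ^ 2 + p.1 j * z)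

/-- The diagonal matrix `Δ(z) = diag (m₁(z), …, mₘ(z), 1)`. -/
def deltaMatrix {m : ℕ} (p : Params m) (z : ℂ) : Matrix (Fin (m + 1)) (Fin (m + 1)) ℂ :=
  Matrix.diagonal (Fin.snoc (α := fun _ => ℂ) (fun j : Fin m => cubicExp p j z) 1)

/-- The matrix `Eⱼ` whose `(j, j)` entry is `1` and whose other entries are `0`. -/
def unitMatrix {m : ℕ} (j : Fin (m + 1)) : Matrix (Fin (m + 1)) (Fin (m + 1)) ℂ :=
  Matrix.single j j 1

/-- The kernel `f(u)ᵀ g(v) / (u - v)` for `u ≠ v`, and `0` for `u = v`. -/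
def integrableKernel {n : ℕ} (f g : ℂ → Fin n → ℂ) (u v : ℂ) : ℂ :=
  if u = v then 0 else dotProduct (f u) (g v) / (u - v)

/-- `f = c Δ F`. -/
def cubicVecLeft {m : ℕ} (F : ℂ → Fin (m + 1) → ℂ) (c : ℂ → ℂ) (p : Params m) (u : ℂ) :
    Fin (m + 1) → ℂ :=
  c u • (deltaMatrix p u).mulVec (F u)

/-- `g = c⁻¹ Δ⁻¹ G`. -/
def cubicVecRight {m : ℕ} (G : ℂ → Fin (m + 1) → ℂ) (c : ℂ → ℂ) (p : Params m) (u : ℂ) :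
    Fin (m + 1) → ℂ :=
  (c u)⁻¹ • ((deltaMatrix p u)⁻¹).mulVec (G u)

/-- A cubic integrable operator on `L²(Ω)`, for the parameters in the set `U`. The functions
`F`, `G`, `c` matter on `Ω` only. -/
structure CubicIntegrableOperator (X : SpectralSet) (m : ℕ) (U : Set (Params m)) where
  /-- the vector function `F`, independent of the parameters -/
  F : ℂ → Fin (m + 1) → ℂ
  /-- the vector function `G`, independent of the parameters -/
  G : ℂ → Fin (m + 1) → ℂ
  /-- the scalar function `c`, which may depend on the parameters -/
  c : Params m → ℂ → ℂ
  /-- the bounded operator `H` on `L²(Ω)` -/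
  H : Params m → X.Hilb →L[ℂ] X.Hilb
  F_measurable : ∀ j, AEStronglyMeasurable (fun u => F u j) X.absMeasure
  G_measurable : ∀ j, AEStronglyMeasurable (fun u => G u j) X.absMeasure
  c_measurable : ∀ p ∈ U, AEStronglyMeasurable (c p) X.absMeasure
  orthogonal : ∀ u ∈ X.carrier, ∀ j, dotProduct (F u) ((unitMatrix j).mulVec (G u)) = 0
  c_ne_zero : ∀ p ∈ U, ∀ u ∈ X.carrier, c p u ≠ 0
  f_memLp : ∀ p ∈ U, ∀ j, MemLp (fun u => cubicVecLeft F (c p) p u j) 2 X.absMeasure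
  f_memLp_top : ∀ p ∈ U, ∀ j, MemLp (fun u => cubicVecLeft F (c p) p u j) ∞ X.absMeasure
  g_memLp : ∀ p ∈ U, ∀ j, MemLp (fun u => cubicVecRight G (c p) p u j) 2 X.absMeasure
  g_memLp_top : ∀ p ∈ U, ∀ j, MemLp (fun u => cubicVecRight G (c p) p u j) ∞ X.absMeasure
  H_kernel : ∀ p ∈ U, X.IsIntegralOperator (H p)
    (integrableKernel (cubicVecLeft F (c p) p) (cubicVecRight G (c p) p))

namespace CubicIntegrableOperator

variable {X : SpectralSet} {m : ℕ} {U : Set (Params m)}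

/-- The vector function `f`. -/
def f (K : CubicIntegrableOperator X m U) (p : Params m) : ℂ → Fin (m + 1) → ℂ :=
  cubicVecLeft K.F (K.c p) p

/-- The vector function `g`. -/
def g (K : CubicIntegrableOperator X m U) (p : Params m) : ℂ → Fin (m + 1) → ℂ :=
  cubicVecRight K.G (K.c p) p

/-- The `j`-th component of `f` as an element of `L²(Ω)`. -/
def fL2 (K : CubicIntegrableOperator X m U) {p : Params m} (hp : p ∈ U) (j : Fin (m + 1)) :
    X.Hilb :=
  (K.f_memLp p hp j).toLp _

/-- The matrix `Y₁ = ∫_Ω ((1 - H)⁻¹ f)(s) g(s)ᵀ dμ(s)`, to be used when `1 - H` is invertible. -/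
def Y₁ (K : CubicIntegrableOperator X m U) {p : Params m} (hp : p ∈ U) :
    Matrix (Fin (m + 1)) (Fin (m + 1)) ℂ :=
  Matrix.of fun j k => X.integral fun s =>
    (Ring.inverse (1 - K.H p) (K.fL2 hp j) : X.Hilb) s * K.g p s k

/-- The vector functions `f` and `g` depend continuously on the parameters in `L²(Ω)`, and the
operator `H` does so in trace norm. -/
def ContinuousDependence (K : CubicIntegrableOperator X m U) : Prop :=
  ∀ p ∈ U,
    (∀ j, Tendsto (fun q => eLpNorm (fun u => K.f q u j - K.f p u j) 2 X.absMeasure)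
      (𝓝[U] p) (𝓝 0)) ∧
    (∀ j, Tendsto (fun q => eLpNorm (fun u => K.g q u j - K.g p u j) 2 X.absMeasure)
      (𝓝[U] p) (𝓝 0)) ∧
    Tendsto (fun q => traceNorm (K.H q - K.H p)) (𝓝[U] p) (𝓝 0)

end CubicIntegrableOperator

end

/-! Moving `xᵢ` by `h` multiplies only the product `fᵢ(u) gᵢ(v)` by `exp (h (u - v))`, apart from
the scalar `c`. Dividing by `u - v`, the new kernel is the old one plus `(exp (h (u - v)) - 1) / (u
- v) · fᵢ(u) gᵢ(v)`, conjugated by the ratio of the new and the old `c` (`integrableKernel_update`).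
Conjugation does not change the determinant (`fredholmDet_eq_of_kernel_conj`), and for bounded `u`,
`v` the added kernel is `h fᵢ(u) gᵢ(v)` up to `O(h²)` in nuclear norm. So `H` moves by `h R + O(h²)`
with `R = fᵢ ⊗ gᵢ` of rank one. Since the determinant is affine along `R`, its derivative is `det (1
- H - R) - det (1 - H)`, which for invertible `1 - H` equals `-det (1 - H) ∫ ((1 - H)⁻¹ fᵢ) gᵢ dμ`.

As `Ω` may be unbounded, the `O(h²)` holds only after compression by the cut-offs `Pₙ` to discs. The
derivatives of `det (1 - Pₙ H)` are expressed by determinants whose continuity in the parameter is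
uniform in `n`, because `H` is continuous in trace norm and `f`, `g` in `L²`. The mean value
inequality then lets `n → ∞` (`hasDerivAt_fredholmDet_of_compressions`). The affine formula needs no
inverse, so the compressions need not be invertible.

The determinant theory rests on one estimate, that the absolute values of the principal minors add
up to at most `exp r` for nuclear norm at most `r`. It gives convergence and, through Cauchy's
estimate, local Lipschitz continuity in nuclear norm. Multiplicativity and cyclicity then pass to
the limit from finite sections. -/

noncomputable section

/-! ### Principal minors and bounds from the Cauchy-Binet formula -/

namespace Matrix

/-- `det (1 - M)` is the alternating sum of the principal minors of `M`. -/
theorem det_one_sub_eq_sum_principal_minors {n R : Type*} [Fintype n] [DecidableEq n] [CommRing R]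
    (M : Matrix n n R) :
    det (1 - M) = ∑ S : Finset n, (-1) ^ S.card *
      (M.submatrix (Subtype.val : S → n) (Subtype.val : S → n)).det := by
  have h : det (1 - M) = ∑ S : Finset n,
      (detRowAlternating : (n → R) [⋀^n]→ₗ[R] R) (S.piecewise (-M).row (1 : Matrix n n R).row) := by
    rw [← AlternatingMap.map_add_univ, sub_eq_neg_add]
    rfl
  rw [h]
  refine Finset.sum_congr rfl fun S _ => ?_
  have h2 := det_piecewise_one_eq_submatrix_det (-M) S
  rw [submatrix_neg] at h2
  simp only [Pi.neg_apply, det_neg, Fintype.card_coe] at h2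
  rw [← h2]
  rfl

/-- The Cauchy-Binet formula, as a sum over all tuples of indices. -/
theorem factorial_mul_det_mul {m n R : Type*} [Fintype m] [DecidableEq m] [Fintype n]
    [DecidableEq n] [CommRing R] (A : Matrix n m R) (B : Matrix m n R) :
    ((Fintype.card n).factorial : R) * det (A * B) =
      ∑ σ : n → m, det (A.submatrix id σ) * det (B.submatrix σ id) := by
  have h1 : det (A * B) = ∑ σ : n → m, det (A.submatrix id σ) * ∏ j, B (σ j) j := by
    rw [← det_transpose]
    have := (detRowAlternating : (n → R) [⋀^n]→ₗ[R] R).toMultilinearMap.map_sum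
      (fun j (l : m) => (B l j • fun i => A i l : n → R))
    have h2 : (A * B)ᵀ = fun j => ∑ l, (B l j • fun i => A i l : n → R) := by
      ext j i
      simp [mul_apply, Finset.sum_apply, mul_comm]
    rw [h2]
    refine this.trans (Finset.sum_congr rfl fun σ _ => ?_)
    rw [MultilinearMap.map_smul_univ, smul_eq_mul, mul_comm, ← det_transpose (A.submatrix id σ)]
    rfl
  -- Reindexing by `σ ∘ π` produces the sign of `π`. Summing over all `π` completes the product of
  -- entries of `B` to a determinant and accounts for the factorial.
  have h3 : ∀ π : Equiv.Perm n,
      det (A * B) = ∑ σ : n → m, det (A.submatrix id σ) * ((Equiv.Perm.sign π : ℤ) : R) *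
        ∏ j, B (σ (π j)) j := by
    intro π
    rw [h1, ← Equiv.sum_comp (Equiv.arrowCongr π.symm (Equiv.refl m))]
    refine Finset.sum_congr rfl fun σ _ => ?_
    have h4 : Equiv.arrowCongr π.symm (Equiv.refl m) σ = σ ∘ π := rfl
    have h5 : A.submatrix id (σ ∘ π) = (A.submatrix id σ).submatrix id π := rfl
    rw [h4, h5, det_permute', mul_comm (det _)]
    rfl
  have h6 : ∑ π : Equiv.Perm n, det (A * B) = ((Fintype.card n).factorial : R) * det (A * B) := by
    rw [Finset.sum_const, Finset.card_univ, Fintype.card_perm, nsmul_eq_mul]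
  rw [← h6, Finset.sum_congr rfl fun π _ => h3 π, Finset.sum_comm]
  refine Finset.sum_congr rfl fun σ _ => ?_
  rw [det_apply' (B.submatrix σ id), Finset.mul_sum]
  refine Finset.sum_congr rfl fun π _ => ?_
  simp [mul_assoc]

-- Hadamard's inequality for a Gram matrix: the eigenvalues are nonnegative with sum at most the
-- size of the matrix, and `t ≤ exp (t - 1)` bounds their product by `1`.
open scoped ComplexOrder in
theorem norm_det_conjTranspose_mul_self_le_one {m n : Type*} [Fintype m] [Fintype n] [DecidableEq n]
    (A : Matrix m n ℂ) (hA : ∀ j, ∑ i, ‖A i j‖ ^ 2 ≤ 1) : ‖det (Aᴴ * A)‖ ≤ 1 := by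
  have hp := posSemidef_conjTranspose_mul_self A
  have ht : (∑ j, hp.1.eigenvalues j : ℝ) ≤ Fintype.card n := by
    have h1 := hp.1.trace_eq_sum_eigenvalues
    have h2 : trace (Aᴴ * A) = ((∑ j, ∑ i, ‖A i j‖ ^ 2 : ℝ) : ℂ) := by
      simp [trace, mul_apply, Complex.conj_mul']
    rw [h2] at h1
    have h3 : (∑ j, ∑ i, ‖A i j‖ ^ 2 : ℝ) = ∑ j, hp.1.eigenvalues j := by
      exact Complex.ofReal_injective (by rw [h1]; simp)
    rw [← h3]
    exact (Finset.sum_le_sum fun j _ => hA j).trans (by simp)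
  rw [hp.1.det_eq_prod_eigenvalues, norm_prod]
  calc ∏ j, ‖((hp.1.eigenvalues j : ℝ) : ℂ)‖ ≤ ∏ j, Real.exp (hp.1.eigenvalues j - 1) := by
        refine Finset.prod_le_prod (fun _ _ => norm_nonneg _) fun j _ => ?_
        rw [Complex.norm_real, Real.norm_of_nonneg (hp.eigenvalues_nonneg j)]
        linarith [Real.add_one_le_exp (hp.1.eigenvalues j - 1)]
    _ = Real.exp (∑ j, (hp.1.eigenvalues j - 1)) := (Real.exp_sum _ _).symm
    _ ≤ 1 := by
        rw [Real.exp_le_one_iff, Finset.sum_sub_distrib]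
        simpa using ht

/-- By Cauchy-Binet for `Aᴴ * A`, the sum is the factorial times a Gram determinant. -/
theorem sum_norm_sq_det_submatrix_le {m n : Type*} [Fintype m] [DecidableEq m] [Fintype n]
    [DecidableEq n] (A : Matrix m n ℂ) (hA : ∀ j, ∑ i, ‖A i j‖ ^ 2 ≤ 1) :
    ∑ σ : n → m, ‖det (A.submatrix σ id)‖ ^ 2 ≤ (Fintype.card n).factorial := by
  have h1 := factorial_mul_det_mul Aᴴ A
  have h2 : ∀ σ : n → m, det (Aᴴ.submatrix id σ) * det (A.submatrix σ id) =
      ((‖det (A.submatrix σ id)‖ ^ 2 : ℝ) : ℂ) := by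
    intro σ
    rw [← conjTranspose_submatrix, det_conjTranspose, Complex.star_def, Complex.conj_mul']
    simp
  simp only [h2] at h1
  have h3 : (∑ σ : n → m, ‖det (A.submatrix σ id)‖ ^ 2) =
      (Fintype.card n).factorial * ‖det (Aᴴ * A)‖ := by
    have := congrArg norm h1
    rw [norm_mul, ← Complex.ofReal_sum, Complex.norm_real, Complex.norm_natCast,
      Real.norm_of_nonneg (Finset.sum_nonneg fun _ _ => sq_nonneg _)] at this
    exact this.symm
  rw [h3]
  exact mul_le_of_le_one_right (by positivity) (norm_det_conjTranspose_mul_self_le_one A hA)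

/-- After Cauchy-Binet, `|xy| ≤ (x² + y²) / 2` separates the minors of `A` and `B`. The sum over `s`
then costs one factorial, which cancels the one in Cauchy-Binet, and the weights add up to `(∑ r)ⁿ`.
-/
theorem sum_norm_det_submatrix_mul_diagonal_mul_le {m n N : Type*} [Fintype m] [DecidableEq m]
    [Fintype n] [DecidableEq n] [Fintype N] [DecidableEq N] (A : Matrix m N ℂ) (B : Matrix N m ℂ)
    (r : N → ℝ) (hr : ∀ l, 0 ≤ r l) (hA : ∀ l, ∑ i, ‖A i l‖ ^ 2 ≤ 1)
    (hB : ∀ l, ∑ i, ‖B l i‖ ^ 2 ≤ 1) :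
    ∑ s : n → m, ‖det ((A * diagonal (fun l => (r l : ℂ)) * B).submatrix s s)‖ ≤
      (∑ l, r l) ^ Fintype.card n := by
  set k : ℝ := ((Fintype.card n).factorial : ℝ) with hk
  have hk0 : 0 < k := by positivity
  have h1 : ∀ s : n → m, k * ‖det ((A * diagonal (fun l => (r l : ℂ)) * B).submatrix s s)‖ ≤
      ∑ σ : n → N, (∏ j, r (σ j)) *
        ((‖det (A.submatrix s σ)‖ ^ 2 + ‖det (B.submatrix σ s)‖ ^ 2) / 2) := by
    intro s
    have h2 : (A * diagonal (fun l => (r l : ℂ)) * B).submatrix s s =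
        A.submatrix s id * (diagonal (fun l => (r l : ℂ)) * B.submatrix id s) := by
      rw [Matrix.mul_assoc]
      ext i j
      simp [mul_apply, diagonal_apply]
    have h3 := congrArg norm (factorial_mul_det_mul (A.submatrix s id)
      (diagonal (fun l => (r l : ℂ)) * B.submatrix id s))
    rw [norm_mul, Complex.norm_natCast] at h3
    rw [h2, hk, h3]
    refine (norm_sum_le _ _).trans (Finset.sum_le_sum fun σ _ => ?_)
    have h4 : (diagonal (fun l => (r l : ℂ)) * B.submatrix id s).submatrix σ id =
        diagonal (fun j => (r (σ j) : ℂ)) * B.submatrix σ s := by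
      ext i j
      simp [mul_apply, diagonal_apply]
    rw [h4, det_mul, det_diagonal, norm_mul, norm_mul, norm_prod]
    simp only [Complex.norm_real, Real.norm_of_nonneg (hr _), submatrix_submatrix,
      CompTriple.comp_eq]
    have h5 : 0 ≤ ∏ j, r (σ j) := Finset.prod_nonneg fun _ _ => hr _
    nlinarith [mul_nonneg h5 (sq_nonneg (‖det (A.submatrix s σ)‖ - ‖det (B.submatrix σ s)‖))]
  have h6 : k * ∑ s : n → m, ‖det ((A * diagonal (fun l => (r l : ℂ)) * B).submatrix s s)‖ ≤
      k * (∑ l, r l) ^ Fintype.card n := by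
    rw [Finset.mul_sum]
    refine (Finset.sum_le_sum fun s _ => h1 s).trans ?_
    rw [Finset.sum_comm, show (∑ l, r l) ^ Fintype.card n = ∑ σ : n → N, ∏ j, r (σ j) by
      rw [← Fintype.piFinset_univ, ← Finset.prod_univ_sum]; simp, Finset.mul_sum]
    refine Finset.sum_le_sum fun σ _ => ?_
    rw [← Finset.mul_sum, mul_comm k]
    refine mul_le_mul_of_nonneg_left ?_ (Finset.prod_nonneg fun _ _ => hr _)
    rw [← Finset.sum_div, Finset.sum_add_distrib]
    have hA' := sum_norm_sq_det_submatrix_le (A.submatrix id σ) (fun j => hA (σ j))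
    have hB' := sum_norm_sq_det_submatrix_le (B.submatrix σ id)ᵀ (fun j => hB (σ j))
    simp only [transpose_submatrix, submatrix_submatrix,
      CompTriple.comp_eq] at hA' hB'
    have hB'' : ∑ s : n → m, ‖det (B.submatrix σ s)‖ ^ 2 ≤ k := by
      refine (Finset.sum_congr rfl fun s _ => ?_).trans_le hB'
      rw [← det_transpose, transpose_submatrix]
    linarith
  exact le_of_mul_le_mul_left h6 hk0

/-- A set of size `k` has `k!` enumerations, all with the same minor, and the fibres of `s ↦ image
s` over different sets are disjoint. -/
theorem factorial_mul_sum_norm_det_principal_minors_le {m : Type*} [Fintype m] [DecidableEq m]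
    (M : Matrix m m ℂ) (k : ℕ) :
    k.factorial * ∑ S ∈ Finset.univ.powersetCard k,
      ‖(M.submatrix (Subtype.val : S → m) (Subtype.val : S → m)).det‖ ≤
      ∑ s : Fin k → m, ‖det (M.submatrix s s)‖ := by
  have hfib : ∀ S ∈ (Finset.univ : Finset m).powersetCard k, (k.factorial : ℝ) *
      ‖(M.submatrix (Subtype.val : S → m) (Subtype.val : S → m)).det‖ ≤
      ∑ s : Fin k → m with Finset.univ.image s = S, ‖det (M.submatrix s s)‖ := by
    intro S hS
    have hc : S.card = k := (Finset.mem_powersetCard.mp hS).2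
    have hcard : Fintype.card (Fin k ≃ S) = k.factorial := by
      rw [Fintype.card_equiv (Fintype.equivOfCardEq (by simp [hc]))]
      simp
    have h1 : (k.factorial : ℝ) *
        ‖(M.submatrix (Subtype.val : S → m) (Subtype.val : S → m)).det‖ =
        ∑ e : Fin k ≃ S, ‖det (M.submatrix (Subtype.val ∘ e : Fin k → m) (Subtype.val ∘ e))‖ := by
      have : ∀ e : Fin k ≃ S, det (M.submatrix (Subtype.val ∘ e : Fin k → m) (Subtype.val ∘ e)) =
          (M.submatrix (Subtype.val : S → m) (Subtype.val : S → m)).det := by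
        intro e
        rw [← det_submatrix_equiv_self e, submatrix_submatrix]
      simp only [this]
      rw [Finset.sum_const, Finset.card_univ, hcard, nsmul_eq_mul]
    rw [h1]
    have hinj : Function.Injective (fun e : Fin k ≃ S => (Subtype.val ∘ e : Fin k → m)) := by
      intro e e' h
      ext i
      exact congrFun h i
    rw [← Finset.sum_image (f := fun s : Fin k → m => ‖det (M.submatrix s s)‖)
      (fun e _ e' _ h => hinj h)]
    refine Finset.sum_le_sum_of_subset_of_nonneg ?_ fun _ _ _ => norm_nonneg _
    intro s hs
    obtain ⟨e, -, rfl⟩ := Finset.mem_image.mp hs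
    simp only [Finset.mem_filter, Finset.mem_univ, true_and]
    ext x
    simp only [Finset.mem_image, Finset.mem_univ, true_and, Function.comp]
    constructor
    · rintro ⟨i, rfl⟩
      exact (e i).2
    · intro hx
      exact ⟨e.symm ⟨x, hx⟩, by simp⟩
  rw [Finset.mul_sum]
  refine (Finset.sum_le_sum hfib).trans ?_
  rw [← Finset.sum_biUnion]
  · exact Finset.sum_le_sum_of_subset_of_nonneg (Finset.subset_univ _) fun _ _ _ => norm_nonneg _
  · intro S _ S' _ h
    rw [Function.onFun, Finset.disjoint_filter]
    rintro s - rfl h'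
    exact h h'

/-- Minors of size `k` contribute at most `(∑ r)ᵏ / k!`. The bound involves neither the size of the
matrix nor the number of rank one terms, so it survives both limits. -/
theorem sum_norm_det_principal_minors_le {m N : Type*} [Fintype m] [DecidableEq m]
    [Fintype N] [DecidableEq N] (A : Matrix m N ℂ) (B : Matrix N m ℂ)
    (r : N → ℝ) (hr : ∀ l, 0 ≤ r l) (hA : ∀ l, ∑ i, ‖A i l‖ ^ 2 ≤ 1)
    (hB : ∀ l, ∑ i, ‖B l i‖ ^ 2 ≤ 1) :
    ∑ S : Finset m, ‖((A * diagonal (fun l => (r l : ℂ)) * B).submatrix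
      (Subtype.val : S → m) (Subtype.val : S → m)).det‖ ≤ Real.exp (∑ l, r l) := by
  set M := A * diagonal (fun l => (r l : ℂ)) * B
  rw [← Finset.powerset_univ, Finset.sum_powerset]
  have h : ∀ k : ℕ, ∑ S ∈ (Finset.univ : Finset m).powersetCard k,
      ‖(M.submatrix (Subtype.val : S → m) (Subtype.val : S → m)).det‖ ≤
      (∑ l, r l) ^ k / k.factorial := by
    intro k
    rw [le_div_iff₀ (by positivity), mul_comm]
    have := sum_norm_det_submatrix_mul_diagonal_mul_le (n := Fin k) A B r hr hA hB
    rw [Fintype.card_fin] at this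
    exact (factorial_mul_sum_norm_det_principal_minors_le M k).trans this
  refine (Finset.sum_le_sum fun k _ => h k).trans ?_
  exact Real.sum_le_exp_of_nonneg (Finset.sum_nonneg fun l _ => hr l) _

/-- The determinant is affine along rank one perturbations. -/
theorem det_sub_smul_vecMulVec {n R : Type*} [Fintype n] [DecidableEq n] [CommRing R]
    (A : Matrix n n R) (u v : n → R) (z : R) :
    det (A - z • vecMulVec u v) = det A + z * (det (A - vecMulVec u v) - det A) := by
  -- Bordering `A` by the column `u` and the row `w • v` makes the perturbed matrix a Schur
  -- complement, so that `w` enters through a single row.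
  set B : Matrix (n ⊕ Unit) (n ⊕ Unit) R := fromBlocks A (replicateCol Unit u) 0 1
  have h : ∀ w : R, det (A - w • vecMulVec u v) =
      w * det (B.updateRow (Sum.inr ()) (Sum.elim v 0)) +
        det (B.updateRow (Sum.inr ()) (Sum.elim 0 1)) := by
    intro w
    rw [← det_updateRow_smul, ← det_updateRow_add]
    have h1 : B.updateRow (Sum.inr ()) (w • Sum.elim v 0 + (Sum.elim 0 1 : n ⊕ Unit → R)) =
        fromBlocks A (replicateCol Unit u) (replicateRow Unit (w • v)) 1 := by
      ext (i | i) (j | j) <;> simp [B, updateRow_apply]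
    rw [h1, det_fromBlocks_one₂₂]
    congr 2
    ext i j
    simp [mul_apply, vecMulVec_apply, mul_left_comm]
  have h0 := h 0
  have h1 := h 1
  rw [zero_smul, sub_zero] at h0
  rw [one_smul] at h1
  rw [h z, h0, h1]
  ring

end Matrix

/-! ### Nuclear norm bounds and convergence in nuclear norm -/

section Nuclear

variable {E : Type*} [NormedAddCommGroup E] [InnerProductSpace ℂ E]

/-- The nuclear norm of `T` is at most `r`, and attained up to a nuclear representation with an
arbitrary index type. -/
def NuclearNormLE (T : E →L[ℂ] E) (r : ℝ) : Prop :=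
  ∃ (κ : Type) (a b : κ → E) (s : ℝ), HasSum (fun k => ‖a k‖ * ‖b k‖) s ∧ s ≤ r ∧
    ∀ x : E, HasSum (fun k => inner ℂ (b k) x • a k) (T x)

theorem IsNuclearRep.nuclearNormLE {T : E →L[ℂ] E} {a b : ℕ → E} {r : ℝ}
    (h : IsNuclearRep T a b r) : NuclearNormLE T r :=
  ⟨ℕ, a, b, r, h.1, le_rfl, h.2⟩

namespace NuclearNormLE

variable {T S : E →L[ℂ] E} {r s : ℝ}

theorem mono (h : NuclearNormLE T r) (hrs : r ≤ s) : NuclearNormLE T s := by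
  obtain ⟨κ, a, b, t, h1, h2, h3⟩ := h
  exact ⟨κ, a, b, t, h1, h2.trans hrs, h3⟩

theorem nonneg (h : NuclearNormLE T r) : 0 ≤ r := by
  obtain ⟨κ, a, b, t, h1, h2, h3⟩ := h
  exact (h1.nonneg fun k => by positivity).trans h2

theorem rankOne (x y : E) : NuclearNormLE (InnerProductSpace.rankOne ℂ x y) (‖x‖ * ‖y‖) := by
  refine ⟨Unit, fun _ => x, fun _ => y, ‖x‖ * ‖y‖, ?_, le_rfl, fun z => ?_⟩
  · simp
  · simp

theorem zero : NuclearNormLE (0 : E →L[ℂ] E) 0 := by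
  simpa using rankOne (0 : E) 0

theorem comp_left (A : E →L[ℂ] E) (h : NuclearNormLE T r) : NuclearNormLE (A * T) (‖A‖ * r) := by
  obtain ⟨κ, a, b, t, h1, h2, h3⟩ := h
  have h4 : ∀ k, ‖A (a k)‖ * ‖b k‖ ≤ ‖A‖ * (‖a k‖ * ‖b k‖) := fun k => by
    rw [← mul_assoc]
    exact mul_le_mul_of_nonneg_right (A.le_opNorm _) (norm_nonneg _)
  have h5 : Summable fun k => ‖A (a k)‖ * ‖b k‖ :=
    Summable.of_nonneg_of_le (fun k => by positivity) h4 (h1.mul_left _).summable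
  refine ⟨κ, fun k => A (a k), b, _, h5.hasSum, ?_, fun x => ?_⟩
  · exact (hasSum_le h4 h5.hasSum (h1.mul_left _)).trans
      (mul_le_mul_of_nonneg_left h2 (norm_nonneg _))
  · simpa using A.hasSum (h3 x)

theorem smul (c : ℂ) (h : NuclearNormLE T r) : NuclearNormLE (c • T) (‖c‖ * r) := by
  obtain ⟨κ, a, b, t, h1, h2, h3⟩ := h
  refine ⟨κ, fun k => c • a k, b, ‖c‖ * t, ?_, mul_le_mul_of_nonneg_left h2 (norm_nonneg _),
    fun x => ?_⟩
  · simpa [norm_smul, mul_assoc] using h1.mul_left ‖c‖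
  · simpa [smul_comm c] using (h3 x).const_smul c

theorem neg (h : NuclearNormLE T r) : NuclearNormLE (-T) r := by
  simpa using h.smul (-1)

variable [CompleteSpace E]

theorem comp_right (A : E →L[ℂ] E) (h : NuclearNormLE T r) : NuclearNormLE (T * A) (r * ‖A‖) := by
  obtain ⟨κ, a, b, t, h1, h2, h3⟩ := h
  have h4 : ∀ k, ‖a k‖ * ‖A.adjoint (b k)‖ ≤ ‖a k‖ * ‖b k‖ * ‖A‖ := fun k => by
    rw [mul_assoc, mul_comm ‖b k‖]
    refine mul_le_mul_of_nonneg_left ((A.adjoint.le_opNorm _).trans_eq ?_) (norm_nonneg _)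
    rw [LinearIsometryEquiv.norm_map]
  have h5 : Summable fun k => ‖a k‖ * ‖A.adjoint (b k)‖ :=
    Summable.of_nonneg_of_le (fun k => by positivity) h4 (h1.mul_right _).summable
  refine ⟨κ, a, fun k => A.adjoint (b k), _, h5.hasSum, ?_, fun x => ?_⟩
  · exact (hasSum_le h4 h5.hasSum (h1.mul_right _)).trans
      (mul_le_mul_of_nonneg_right h2 (norm_nonneg _))
  · simpa [ContinuousLinearMap.adjoint_inner_left] using h3 (A x)

/-- Representations are concatenated over a sigma type. Allowing arbitrary index types in
`NuclearNormLE` avoids any enumeration here. -/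
theorem of_hasSum {κ : Type} {T : κ → E →L[ℂ] E} {r : κ → ℝ} {S : E →L[ℂ] E} {s : ℝ}
    (h : ∀ k, NuclearNormLE (T k) (r k)) (hr : HasSum r s)
    (hS : ∀ x, HasSum (fun k => T k x) (S x)) : NuclearNormLE S s := by
  choose J a b t h1 h2 h3 using h
  have h0 : ∀ k, 0 ≤ t k := fun k => (h1 k).nonneg fun j => by positivity
  have h4 : Summable fun p : Σ k, J k => ‖a p.1 p.2‖ * ‖b p.1 p.2‖ := by
    rw [summable_sigma_of_nonneg (fun p => by positivity)]
    refine ⟨fun k => (h1 k).summable, ?_⟩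
    simp only [(h1 _).tsum_eq]
    exact Summable.of_nonneg_of_le h0 h2 hr.summable
  have h5 : HasSum t (∑' p : Σ k, J k, ‖a p.1 p.2‖ * ‖b p.1 p.2‖) := h4.hasSum.sigma h1
  refine ⟨Σ k, J k, fun p => a p.1 p.2, fun p => b p.1 p.2, _, h4.hasSum, hasSum_le h2 h5 hr,
    fun x => ?_⟩
  have h6 : Summable fun p : Σ k, J k => inner ℂ (b p.1 p.2) x • a p.1 p.2 := by
    refine Summable.of_norm_bounded (h4.mul_right ‖x‖) fun p => ?_
    rw [norm_smul, mul_comm, mul_assoc]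
    exact mul_le_mul_of_nonneg_left (norm_inner_le_norm _ _) (norm_nonneg _)
  have h7 := h6.hasSum.sigma (fun k => h3 k x)
  rw [← h7.unique (hS x)]
  exact h6.hasSum

theorem add (hT : NuclearNormLE T r) (hS : NuclearNormLE S s) : NuclearNormLE (T + S) (r + s) := by
  refine of_hasSum (κ := Bool) (T := fun c => bif c then T else S)
    (r := fun c => bif c then r else s) ?_ ?_ fun x => ?_
  · rintro (_ | _)
    · exact hS
    · exact hT
  · simpa using hasSum_fintype (fun c : Bool => bif c then r else s)
  · simpa using hasSum_fintype (fun c : Bool => (bif c then T else S) x)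

theorem sub (hT : NuclearNormLE T r) (hS : NuclearNormLE S s) : NuclearNormLE (T - S) (r + s) := by
  rw [sub_eq_add_neg]
  exact hT.add hS.neg

end NuclearNormLE

/-- The operators `T a` converge to `S` in nuclear norm along `l`. -/
def NuclearTendsto {α : Type*} (T : α → E →L[ℂ] E) (l : Filter α) (S : E →L[ℂ] E) : Prop :=
  ∃ r : α → ℝ, (∀ a, NuclearNormLE (T a - S) (r a)) ∧ Tendsto r l (𝓝 0)

/-- Strong convergence of uniformly bounded operators `A a` implies convergence of `A a * T` in
nuclear norm. -/
theorem NuclearNormLE.tendsto_mul {α : Type*} {l : Filter α} {T : E →L[ℂ] E} {r : ℝ}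
    (h : NuclearNormLE T r) {A : α → E →L[ℂ] E} {C : ℝ} (hC : ∀ i, ‖A i‖ ≤ C)
    (hA : ∀ x, Tendsto (fun i => A i x) l (𝓝 x)) : NuclearTendsto (fun i => A i * T) l T := by
  obtain ⟨κ, a, b, t, h1, h2, h3⟩ := h
  have h4 : ∀ i k, ‖A i (a k) - a k‖ * ‖b k‖ ≤ (C + 1) * (‖a k‖ * ‖b k‖) := fun i k => by
    rw [← mul_assoc]
    refine mul_le_mul_of_nonneg_right ((norm_sub_le _ _).trans ?_) (norm_nonneg _)
    rw [add_mul, one_mul]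
    gcongr
    exact ((A i).le_opNorm _).trans (mul_le_mul_of_nonneg_right (hC i) (norm_nonneg _))
  have h5 : ∀ i, Summable fun k => ‖A i (a k) - a k‖ * ‖b k‖ := fun i =>
    Summable.of_nonneg_of_le (fun k => by positivity) (h4 i) (h1.mul_left _).summable
  refine ⟨fun i => ∑' k, ‖A i (a k) - a k‖ * ‖b k‖, fun i => ?_, ?_⟩
  · refine ⟨κ, fun k => A i (a k) - a k, b, _, (h5 i).hasSum, le_rfl, fun x => ?_⟩
    simpa [smul_sub] using ((A i).hasSum (h3 x)).sub (h3 x)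
  · rw [show (0 : ℝ) = ∑' _ : κ, (0 : ℝ) by simp]
    -- Each term tends to `0` by strong convergence at the single vector `a k`. The uniform bound on
    -- `A` dominates the series.
    refine tendsto_tsum_of_dominated_convergence (h1.mul_left (C + 1)).summable (fun k => ?_)
      (Eventually.of_forall fun i k => ?_)
    · have := ((hA (a k)).sub_const (a k)).norm.mul_const ‖b k‖
      simpa using this
    · rw [Real.norm_of_nonneg (by positivity)]
      exact h4 i k

/-- Strong convergence of uniformly bounded symmetric operators `A a` implies convergence of
`T * A a` in nuclear norm. -/
theorem NuclearNormLE.tendsto_mul_right {α : Type*} {l : Filter α} {T : E →L[ℂ] E} {r : ℝ}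
    (h : NuclearNormLE T r) {A : α → E →L[ℂ] E} {C : ℝ} (hC : ∀ i, ‖A i‖ ≤ C)
    (hA : ∀ x, Tendsto (fun i => A i x) l (𝓝 x))
    (hs : ∀ i x y, inner ℂ (A i x) y = inner ℂ x (A i y)) :
    NuclearTendsto (fun i => T * A i) l T := by
  obtain ⟨κ, a, b, t, h1, h2, h3⟩ := h
  have h4 : ∀ i k, ‖a k‖ * ‖A i (b k) - b k‖ ≤ (C + 1) * (‖a k‖ * ‖b k‖) := fun i k => by
    rw [mul_left_comm]
    refine mul_le_mul_of_nonneg_left ((norm_sub_le _ _).trans ?_) (norm_nonneg _)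
    rw [add_mul, one_mul]
    gcongr
    exact ((A i).le_opNorm _).trans (mul_le_mul_of_nonneg_right (hC i) (norm_nonneg _))
  have h5 : ∀ i, Summable fun k => ‖a k‖ * ‖A i (b k) - b k‖ := fun i =>
    Summable.of_nonneg_of_le (fun k => by positivity) (h4 i) (h1.mul_left _).summable
  refine ⟨fun i => ∑' k, ‖a k‖ * ‖A i (b k) - b k‖, fun i => ?_, ?_⟩
  · refine ⟨κ, a, fun k => A i (b k) - b k, _, (h5 i).hasSum, le_rfl, fun x => ?_⟩
    simpa [inner_sub_left, hs, sub_smul] using (h3 (A i x)).sub (h3 x)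
  · rw [show (0 : ℝ) = ∑' _ : κ, (0 : ℝ) by simp]
    refine tendsto_tsum_of_dominated_convergence (h1.mul_left (C + 1)).summable (fun k => ?_)
      (Eventually.of_forall fun i k => ?_)
    · have := ((hA (b k)).sub_const (b k)).norm.const_mul ‖a k‖
      simpa using this
    · rw [Real.norm_of_nonneg (by positivity)]
      exact h4 i k

namespace NuclearTendsto

variable {α : Type*} {l : Filter α} {T : α → E →L[ℂ] E} {S : E →L[ℂ] E}

theorem comp_left (A : E →L[ℂ] E) (h : NuclearTendsto T l S) :
    NuclearTendsto (fun i => A * T i) l (A * S) := by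
  obtain ⟨r, h1, h2⟩ := h
  refine ⟨fun i => ‖A‖ * r i, fun i => ?_, by simpa using h2.const_mul ‖A‖⟩
  rw [← mul_sub]
  exact (h1 i).comp_left A

theorem comp_right [CompleteSpace E] (A : E →L[ℂ] E) (h : NuclearTendsto T l S) :
    NuclearTendsto (fun i => T i * A) l (S * A) := by
  obtain ⟨r, h1, h2⟩ := h
  refine ⟨fun i => r i * ‖A‖, fun i => ?_, by simpa using h2.mul_const ‖A‖⟩
  rw [← sub_mul]
  exact (h1 i).comp_right A

theorem const_sub (A : E →L[ℂ] E) (h : NuclearTendsto T l S) :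
    NuclearTendsto (fun i => A - T i) l (A - S) := by
  obtain ⟨r, h1, h2⟩ := h
  refine ⟨r, fun i => ?_, h2⟩
  have := (h1 i).neg
  rwa [neg_sub, ← sub_sub_sub_cancel_left _ _ A] at this

end NuclearTendsto

end Nuclear

/-! ### Fredholm determinants as limits of finite sections -/

section Fredholm

variable {E : Type*} [NormedAddCommGroup E] [InnerProductSpace ℂ E] {ι : Type*}

/-- The matrix of `T` in the part `F` of the Hilbert basis `b`. -/
def sectionMatrix (b : HilbertBasis ι ℂ E) (F : Finset ι) (T : E →L[ℂ] E) : Matrix F F ℂ :=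
  Matrix.of fun i j => inner ℂ (b i) (T (b j))

open Classical in
/-- The finite section `det (1 - P T P)` of the Fredholm determinant, where `P` is the projection to
the span of the part `F` of the Hilbert basis `b`. -/
def sectionDet (b : HilbertBasis ι ℂ E) (F : Finset ι) (T : E →L[ℂ] E) : ℂ :=
  Matrix.det (1 - sectionMatrix b F T)

/-- The terms of the series that defines the Fredholm determinant. -/
def fredholmTerm (b : HilbertBasis ι ℂ E) (T : E →L[ℂ] E) (S : Finset ι) : ℂ :=
  (-1 : ℂ) ^ S.card *
    letI := Classical.decEq ι
    Matrix.det (Matrix.of fun i j : S => inner ℂ (b i) (T (b j)))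

theorem fredholmTerm_map (b : HilbertBasis ι ℂ E) (T : E →L[ℂ] E) (F : Finset ι) (S : Finset F)
    [DecidableEq S] :
    fredholmTerm b T (S.map (Function.Embedding.subtype _)) = (-1) ^ S.card *
      ((sectionMatrix b F T).submatrix (Subtype.val : S → F) (Subtype.val : S → F)).det := by
  classical
  rw [fredholmTerm, Finset.card_map]
  congr 1
  let e : S ≃ S.map (Function.Embedding.subtype (· ∈ F)) :=
    Equiv.ofBijective (fun x => ⟨x.1.1, Finset.mem_map_of_mem _ x.2⟩)
      ⟨fun x y h => Subtype.ext (Subtype.ext (Subtype.mk.inj h)), fun x => by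
        obtain ⟨y, hy, hyx⟩ := Finset.mem_map.mp x.2
        exact ⟨⟨y, hy⟩, Subtype.ext hyx⟩⟩
  rw [← Matrix.det_submatrix_equiv_self e]
  convert rfl using 2
  ext i j
  rfl

theorem sum_powerset_eq_sum_subtype {M : Type*} [AddCommMonoid M] (F : Finset ι)
    (g : Finset ι → M) :
    ∑ S ∈ F.powerset, g S = ∑ S : Finset F, g (S.map (Function.Embedding.subtype _)) := by
  classical
  symm
  refine Finset.sum_bij (fun S _ => S.map (Function.Embedding.subtype _)) (fun S _ => ?_)
    (fun S _ S' _ h => Finset.map_injective _ h) (fun S hS => ?_) (fun S _ => rfl)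
  · rw [Finset.mem_powerset]
    exact Finset.map_subtype_subset S
  · refine ⟨S.subtype (· ∈ F), Finset.mem_univ _, ?_⟩
    exact Finset.subtype_map_of_mem fun x hx => Finset.mem_powerset.mp hS hx

theorem sectionDet_eq_sum (b : HilbertBasis ι ℂ E) (F : Finset ι) (T : E →L[ℂ] E) :
    sectionDet b F T = ∑ S ∈ F.powerset, fredholmTerm b T S := by
  classical
  rw [sum_powerset_eq_sum_subtype, sectionDet, Matrix.det_one_sub_eq_sum_principal_minors]
  refine Finset.sum_congr rfl fun S _ => ?_
  rw [fredholmTerm_map]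

theorem sum_norm_inner_sq_le_one (b : HilbertBasis ι ℂ E) (F : Finset ι) (x : E) :
    ∑ i : F, ‖inner ℂ (b i) ((‖x‖⁻¹ : ℂ) • x)‖ ^ 2 ≤ 1 := by
  rw [Finset.sum_coe_sort F (fun i => ‖inner ℂ (b i) ((‖x‖⁻¹ : ℂ) • x)‖ ^ 2)]
  refine (b.orthonormal.sum_inner_products_le _).trans ?_
  rw [norm_smul]
  rcases eq_or_ne x 0 with rfl | hx
  · simp
  · simp [norm_ne_zero_iff.mpr hx]

/-- Truncating the nuclear representation writes the section as `A * diagonal * B`, with unit (or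
zero) vectors in `A`, `B` and weights `‖x l‖ * ‖y l‖`. The matrix bound is uniform in the
truncation, and the minors of a finite section are continuous. -/
theorem NuclearNormLE.sum_norm_fredholmTerm_le {T : E →L[ℂ] E} {r : ℝ} (h : NuclearNormLE T r)
    (b : HilbertBasis ι ℂ E) (F : Finset ι) :
    ∑ S ∈ F.powerset, ‖fredholmTerm b T S‖ ≤ Real.exp r := by
  classical
  obtain ⟨κ, x, y, t, h1, h2, h3⟩ := h
  rw [sum_powerset_eq_sum_subtype]
  have hterm : ∀ S : Finset F, ‖fredholmTerm b T (S.map (Function.Embedding.subtype _))‖ =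
      ‖((sectionMatrix b F T).submatrix (Subtype.val : S → F) (Subtype.val : S → F)).det‖ := by
    intro S
    rw [fredholmTerm_map]
    simp
  simp only [hterm]
  let A : ∀ N : Finset κ, Matrix F N ℂ := fun N => Matrix.of fun i l =>
    inner ℂ (b i) ((‖x l‖⁻¹ : ℂ) • x l)
  let B : ∀ N : Finset κ, Matrix N F ℂ := fun N => Matrix.of fun l j =>
    inner ℂ ((‖y l‖⁻¹ : ℂ) • y l) (b j)
  let M : Finset κ → Matrix F F ℂ := fun N =>
    A N * Matrix.diagonal (fun l : N => ((‖x l‖ * ‖y l‖ : ℝ) : ℂ)) * B N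
  have hM : ∀ N i j, M N i j = ∑ l ∈ N, inner ℂ (b i) (x l) * inner ℂ (y l) (b j) := by
    intro N i j
    rw [← Finset.sum_coe_sort]
    refine (Matrix.mul_apply ..).trans ?_
    simp only [Matrix.mul_diagonal]
    refine Finset.sum_congr rfl fun l _ => ?_
    have hnorm : ∀ z : E, ((‖z‖ : ℂ)) • ((‖z‖⁻¹ : ℂ) • z) = z := by
      intro z
      rcases eq_or_ne z 0 with rfl | hz
      · simp
      · rw [smul_smul, mul_inv_cancel₀, one_smul]
        exact_mod_cast norm_ne_zero_iff.mpr hz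
    conv_rhs => rw [← hnorm (x l), ← hnorm (y l)]
    rw [inner_smul_right (b i) _ (‖x l‖ : ℂ), inner_smul_left _ (b j) (‖y l‖ : ℂ)]
    simp only [A, B, Matrix.of_apply, Complex.ofReal_mul, Complex.conj_ofReal]
    ring
  have hlim : Tendsto M atTop (𝓝 (sectionMatrix b F T)) := by
    refine tendsto_pi_nhds.mpr fun i => tendsto_pi_nhds.mpr fun j => ?_
    simp only [hM]
    have := (innerSL ℂ (b i)).hasSum (h3 (b j))
    simpa [HasSum, sectionMatrix, mul_comm] using this
  have hcont : Continuous fun M : Matrix F F ℂ => ∑ S : Finset F,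
      ‖(M.submatrix (Subtype.val : S → F) (Subtype.val : S → F)).det‖ := by
    refine continuous_finsetSum _ fun S _ => ?_
    exact (Continuous.matrix_det (continuous_id.matrix_submatrix _ _)).norm
  refine le_of_tendsto ((hcont.tendsto _).comp hlim) (Eventually.of_forall fun N => ?_)
  refine (Matrix.sum_norm_det_principal_minors_le (A N) (B N) (fun l => ‖x l‖ * ‖y l‖)
    (fun l => by positivity) (fun l => sum_norm_inner_sq_le_one b F (x l)) (fun l => ?_)).trans ?_
  · refine le_of_eq_of_le (Finset.sum_congr rfl fun i _ => ?_) (sum_norm_inner_sq_le_one b F (y l))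
    simp only [B, Matrix.of_apply]
    rw [← inner_conj_symm, RCLike.norm_conj]
  · refine Real.exp_le_exp.mpr (le_trans ?_ h2)
    rw [Finset.sum_coe_sort N (fun l => ‖x l‖ * ‖y l‖)]
    exact sum_le_hasSum N (fun _ _ => by positivity) h1

theorem NuclearNormLE.summable_fredholmTerm {T : E →L[ℂ] E} {r : ℝ} (h : NuclearNormLE T r)
    (b : HilbertBasis ι ℂ E) : Summable (fredholmTerm b T) := by
  classical
  refine Summable.of_norm (summable_of_sum_le (c := Real.exp r) (fun _ => norm_nonneg _) fun u => ?_)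
  -- A finite family of finite sets lies in the powerset of its union.
  refine le_trans (Finset.sum_le_sum_of_subset_of_nonneg (fun S hS => ?_) fun _ _ _ => norm_nonneg _)
    (h.sum_norm_fredholmTerm_le b (u.sup id))
  exact Finset.mem_powerset.mpr (Finset.le_sup (f := id) hS)

theorem NuclearNormLE.tendsto_sectionDet {T : E →L[ℂ] E} {r : ℝ} (h : NuclearNormLE T r)
    (b : HilbertBasis ι ℂ E) :
    Tendsto (fun F => sectionDet b F T) atTop (𝓝 (fredholmDet b T)) := by
  simp only [sectionDet_eq_sum]
  exact (h.summable_fredholmTerm b).hasSum.comp tendsto_finset_powerset_atTop_atTop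

theorem NuclearNormLE.norm_sectionDet_le {T : E →L[ℂ] E} {r : ℝ} (h : NuclearNormLE T r)
    (b : HilbertBasis ι ℂ E) (F : Finset ι) : ‖sectionDet b F T‖ ≤ Real.exp r := by
  rw [sectionDet_eq_sum]
  exact (norm_sum_le _ _).trans (h.sum_norm_fredholmTerm_le b F)

theorem sectionMatrix_add (b : HilbertBasis ι ℂ E) (F : Finset ι) (T S : E →L[ℂ] E) :
    sectionMatrix b F (T + S) = sectionMatrix b F T + sectionMatrix b F S := by
  ext i j
  simp [sectionMatrix]

theorem sectionMatrix_sub (b : HilbertBasis ι ℂ E) (F : Finset ι) (T S : E →L[ℂ] E) :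
    sectionMatrix b F (T - S) = sectionMatrix b F T - sectionMatrix b F S := by
  ext i j
  simp [sectionMatrix]

theorem sectionMatrix_smul (b : HilbertBasis ι ℂ E) (F : Finset ι) (c : ℂ) (T : E →L[ℂ] E) :
    sectionMatrix b F (c • T) = c • sectionMatrix b F T := by
  ext i j
  simp [sectionMatrix]

theorem differentiable_sectionDet (b : HilbertBasis ι ℂ E) (F : Finset ι) (T W : E →L[ℂ] E) :
    Differentiable ℂ fun z : ℂ => sectionDet b F (T + z • W) := by
  simp only [sectionDet, sectionMatrix_add, sectionMatrix_smul, Matrix.det_apply,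
    Matrix.sub_apply, Matrix.add_apply, Matrix.smul_apply]
  fun_prop

/-- The polynomial `z ↦ sectionDet b F (T + z • W)` is at most `exp (r + |z| w)` in absolute value.
Cauchy's estimate on circles of radius `1 / w` bounds its derivative on the unit disc, and the mean
value inequality compares `z = 0` with `z = 1`. -/
theorem norm_sectionDet_add_sub_le [CompleteSpace E]
    {T W : E →L[ℂ] E} {r w : ℝ} (hT : NuclearNormLE T r)
    (hW : NuclearNormLE W w) (b : HilbertBasis ι ℂ E) (F : Finset ι) :
    ‖sectionDet b F (T + W) - sectionDet b F T‖ ≤ w * Real.exp (r + w + 1) := by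
  -- The radius `v⁻¹` requires `v > 0`; the case `w = 0` is reached by letting `v` decrease to `w`.
  have key : ∀ v, 0 < v → w ≤ v →
      ‖sectionDet b F (T + W) - sectionDet b F T‖ ≤ v * Real.exp (r + v + 1) := by
    intro v hv hwv
    have hd := differentiable_sectionDet b F T W
    have hW' := hW.mono hwv
    have hbound : ∀ z ∈ Metric.closedBall (0 : ℂ) 1,
        ‖deriv (fun z : ℂ => sectionDet b F (T + z • W)) z‖ ≤ v * Real.exp (r + v + 1) := by
      intro z hz
      rw [mem_closedBall_zero_iff] at hz
      have := Complex.norm_deriv_le_of_forall_mem_sphere_norm_le (c := z) (R := v⁻¹)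
        (C := Real.exp (r + v + 1)) (by positivity) hd.diffContOnCl fun u hu => by
          refine (NuclearNormLE.norm_sectionDet_le (hT.add (hW'.smul u)) b F).trans ?_
          rw [Real.exp_le_exp, add_assoc]
          have hu' : ‖u‖ ≤ 1 + v⁻¹ := by
            rw [mem_sphere_iff_norm] at hu
            calc ‖u‖ = ‖z + (u - z)‖ := by rw [add_sub_cancel]
              _ ≤ 1 + v⁻¹ := (norm_add_le _ _).trans (by rw [hu]; linarith)
          have h3 := mul_le_mul_of_nonneg_right hu' hv.le
          rw [add_mul, inv_mul_cancel₀ hv.ne', one_mul] at h3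
          linarith
      rwa [div_inv_eq_mul, mul_comm] at this
    have := (convex_closedBall (0 : ℂ) 1).norm_image_sub_le_of_norm_deriv_le
      (fun z _ => hd z) hbound (x := 0) (y := 1) (by simp) (by simp)
    simpa using this
  have hlim : Tendsto (fun v => v * Real.exp (r + v + 1)) (𝓝[>] w)
      (𝓝 (w * Real.exp (r + w + 1))) := by
    have : Continuous fun v : ℝ => v * Real.exp (r + v + 1) := by fun_prop
    exact (this.tendsto w).mono_left nhdsWithin_le_nhds
  refine ge_of_tendsto hlim ?_
  filter_upwards [self_mem_nhdsWithin] with v hv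
  exact key v (hW.nonneg.trans_lt hv) (le_of_lt hv)

theorem norm_fredholmDet_add_sub_le [CompleteSpace E]
    {T W : E →L[ℂ] E} {r w : ℝ} (hT : NuclearNormLE T r)
    (hW : NuclearNormLE W w) (b : HilbertBasis ι ℂ E) :
    ‖fredholmDet b (T + W) - fredholmDet b T‖ ≤ w * Real.exp (r + w + 1) :=
  le_of_tendsto (((hT.add hW).tendsto_sectionDet b).sub (hT.tendsto_sectionDet b)).norm
    (Eventually.of_forall fun F => norm_sectionDet_add_sub_le hT hW b F)

theorem tendsto_mul_exp_zero {α : Type*} {l : Filter α} {r : α → ℝ} (s : ℝ)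
    (hr : Tendsto r l (𝓝 0)) : Tendsto (fun i => r i * Real.exp (s + r i + 1)) l (𝓝 0) := by
  have : Continuous fun v : ℝ => v * Real.exp (s + v + 1) := by fun_prop
  simpa [Function.comp_def] using (this.tendsto 0).comp hr

theorem NuclearTendsto.tendsto_fredholmDet [CompleteSpace E]
    {α : Type*} {l : Filter α} {T : α → E →L[ℂ] E}
    {S : E →L[ℂ] E} {s : ℝ} (h : NuclearTendsto T l S) (hS : NuclearNormLE S s)
    (b : HilbertBasis ι ℂ E) :
    Tendsto (fun i => fredholmDet b (T i)) l (𝓝 (fredholmDet b S)) := by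
  obtain ⟨r, h1, h2⟩ := h
  rw [tendsto_iff_norm_sub_tendsto_zero]
  refine squeeze_zero (fun _ => norm_nonneg _) (fun i => ?_) (tendsto_mul_exp_zero s h2)
  have := norm_fredholmDet_add_sub_le hS (h1 i) b
  rwa [add_sub_cancel] at this

/-- The perturbation bound is uniform in `F`, so the section and the operator may vary together.
This is used for operators that contain the projection `basisProj b F` itself. -/
theorem NuclearTendsto.tendsto_sectionDet [CompleteSpace E]
    {T : Finset ι → E →L[ℂ] E} {S : E →L[ℂ] E} {s : ℝ}
    (h : NuclearTendsto T atTop S) (hS : NuclearNormLE S s) (b : HilbertBasis ι ℂ E) :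
    Tendsto (fun F => sectionDet b F (T F)) atTop (𝓝 (fredholmDet b S)) := by
  obtain ⟨r, h1, h2⟩ := h
  have h3 : Tendsto (fun F => sectionDet b F (T F) - sectionDet b F S) atTop (𝓝 0) := by
    rw [tendsto_zero_iff_norm_tendsto_zero]
    refine squeeze_zero (fun _ => norm_nonneg _) (fun F => ?_) (tendsto_mul_exp_zero s h2)
    have := norm_sectionDet_add_sub_le hS (h1 F) b F
    rwa [add_sub_cancel] at this
  simpa using h3.add (hS.tendsto_sectionDet b)

/-- The orthogonal projection to the span of the part `F` of the Hilbert basis `b`. -/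
def basisProj (b : HilbertBasis ι ℂ E) (F : Finset ι) : E →L[ℂ] E :=
  ∑ i ∈ F, InnerProductSpace.rankOne ℂ (b i) (b i)

theorem basisProj_apply (b : HilbertBasis ι ℂ E) (F : Finset ι) (x : E) :
    basisProj b F x = ∑ i ∈ F, inner ℂ (b i) x • b i := by
  simp [basisProj]

theorem inner_basisProj (b : HilbertBasis ι ℂ E) (F : Finset ι) (x y : E) :
    inner ℂ (basisProj b F x) y = inner ℂ x (basisProj b F y) := by
  simp only [basisProj_apply, inner_sum, sum_inner, inner_smul_left, inner_smul_right,
    inner_conj_symm]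
  exact Finset.sum_congr rfl fun i _ => mul_comm _ _

theorem norm_basisProj_le (b : HilbertBasis ι ℂ E) (F : Finset ι) : ‖basisProj b F‖ ≤ 1 := by
  refine ContinuousLinearMap.opNorm_le_bound _ zero_le_one fun x => ?_
  rw [one_mul]
  have h1 : ‖basisProj b F x‖ ^ 2 = ∑ i ∈ F, ‖inner ℂ (b i) x‖ ^ 2 := by
    have h2 : ((‖basisProj b F x‖ ^ 2 : ℝ) : ℂ) = inner ℂ (basisProj b F x) (basisProj b F x) := by
      rw [inner_self_eq_norm_sq_to_K]
      simp
    rw [basisProj_apply, b.orthonormal.inner_sum] at h2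
    apply Complex.ofReal_injective
    rw [basisProj_apply, h2, Complex.ofReal_sum]
    simp only [Complex.conj_mul', Complex.ofReal_pow]
  exact le_of_sq_le_sq (h1.trans_le (b.orthonormal.sum_inner_products_le x)) (norm_nonneg _)

theorem tendsto_basisProj (b : HilbertBasis ι ℂ E) (x : E) :
    Tendsto (fun F => basisProj b F x) atTop (𝓝 x) := by
  simp only [basisProj_apply, ← b.repr_apply_apply]
  exact b.hasSum_repr x

/-- Compression is multiplicative only up to the projection in the middle, which converges strongly
to `1`. -/
theorem sectionMatrix_mul (b : HilbertBasis ι ℂ E) (F : Finset ι) (T S : E →L[ℂ] E) :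
    sectionMatrix b F T * sectionMatrix b F S = sectionMatrix b F (T * (basisProj b F * S)) := by
  ext i j
  change ∑ k : F, inner ℂ (b i) (T (b k)) * inner ℂ (b k) (S (b j)) =
    inner ℂ (b i) (T (basisProj b F (S (b j))))
  simp only [basisProj_apply, map_sum, map_smul, inner_sum, inner_smul_right]
  rw [← Finset.sum_coe_sort F]
  exact Finset.sum_congr rfl fun k _ => mul_comm (inner ℂ (b i) (T (b k))) _

/-- The Fredholm determinant is multiplicative. -/
theorem fredholmDet_mul [CompleteSpace E] {T S : E →L[ℂ] E} {r s : ℝ} (hT : NuclearNormLE T r)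
    (hS : NuclearNormLE S s) (b : HilbertBasis ι ℂ E) :
    fredholmDet b T * fredholmDet b S = fredholmDet b (T + S - T * S) := by
  classical
  have h1 : ∀ F, sectionDet b F T * sectionDet b F S =
      sectionDet b F (T + S - T * (basisProj b F * S)) := by
    intro F
    rw [sectionDet, sectionDet, sectionDet, ← Matrix.det_mul, sectionMatrix_sub, sectionMatrix_add,
      ← sectionMatrix_mul]
    congr 1
    noncomm_ring
  -- The projections converge only strongly, but next to the nuclear operator `S` this becomes
  -- convergence in nuclear norm.
  have h2 : NuclearTendsto (fun F => T + S - T * (basisProj b F * S)) atTop (T + S - T * S) :=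
    ((hS.tendsto_mul (norm_basisProj_le b) (tendsto_basisProj b)).comp_left T).const_sub _
  refine tendsto_nhds_unique ((hT.tendsto_sectionDet b).mul (hS.tendsto_sectionDet b)) ?_
  simp only [h1]
  exact h2.tendsto_sectionDet ((hT.add hS).sub (hS.comp_left T)) b

/-- Sylvester's identity `det (1 - MN) = det (1 - NM)` for sections. One factor is merely bounded,
so the projection is absorbed into `T`, from the left on one side and from the right on the other.
-/
theorem fredholmDet_mul_comm [CompleteSpace E]
    {T : E →L[ℂ] E} {r : ℝ} (hT : NuclearNormLE T r) (A : E →L[ℂ] E)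
    (b : HilbertBasis ι ℂ E) : fredholmDet b (T * A) = fredholmDet b (A * T) := by
  classical
  have h1 : ∀ F, sectionDet b F (T * (basisProj b F * A)) =
      sectionDet b F (A * (basisProj b F * T)) := by
    intro F
    rw [sectionDet, sectionDet, ← sectionMatrix_mul, ← sectionMatrix_mul,
      Matrix.det_one_sub_mul_comm]
  have h2 : NuclearTendsto (fun F => A * (basisProj b F * T)) atTop (A * T) :=
    (hT.tendsto_mul (norm_basisProj_le b) (tendsto_basisProj b)).comp_left A
  have h3 : NuclearTendsto (fun F => T * (basisProj b F * A)) atTop (T * A) := by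
    simpa only [mul_assoc] using (hT.tendsto_mul_right (norm_basisProj_le b) (tendsto_basisProj b)
      (inner_basisProj b)).comp_right A
  refine tendsto_nhds_unique (h3.tendsto_sectionDet (hT.comp_right A) b) ?_
  simp only [h1]
  exact h2.tendsto_sectionDet (hT.comp_left A) b

theorem fredholmDet_zero (b : HilbertBasis ι ℂ E) : fredholmDet b (0 : E →L[ℂ] E) = 1 := by
  classical
  refine tendsto_nhds_unique (NuclearNormLE.zero.tendsto_sectionDet b) ?_
  have : ∀ F, sectionDet b F (0 : E →L[ℂ] E) = 1 := by
    intro F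
    have : sectionMatrix b F (0 : E →L[ℂ] E) = 0 := by ext i j; simp [sectionMatrix]
    rw [sectionDet, this, sub_zero, Matrix.det_one]
  simp only [this]
  exact tendsto_const_nhds

theorem sectionMatrix_rankOne (b : HilbertBasis ι ℂ E) (F : Finset ι) (x y : E) :
    sectionMatrix b F (InnerProductSpace.rankOne ℂ x y) =
      Matrix.vecMulVec (fun i : F => inner ℂ (b i) x) (fun j : F => inner ℂ y (b j)) := by
  ext i j
  simp [sectionMatrix, Matrix.vecMulVec_apply, mul_comm]

theorem fredholmDet_rankOne (b : HilbertBasis ι ℂ E) (x y : E) :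
    fredholmDet b (InnerProductSpace.rankOne ℂ x y) = 1 - inner ℂ y x := by
  classical
  refine tendsto_nhds_unique ((NuclearNormLE.rankOne x y).tendsto_sectionDet b) ?_
  have h : ∀ F, sectionDet b F (InnerProductSpace.rankOne ℂ x y) =
      1 - inner ℂ y (basisProj b F x) := by
    intro F
    rw [sectionDet, sectionMatrix_rankOne, Matrix.vecMulVec_eq Unit,
      Matrix.det_one_sub_mul_comm, Matrix.det_unique]
    simp only [Matrix.sub_apply, Matrix.one_apply_eq, Matrix.mul_apply, Matrix.replicateRow_apply,
      Matrix.replicateCol_apply, basisProj_apply, inner_sum, inner_smul_right]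
    rw [Finset.sum_coe_sort F (fun i => inner ℂ y (b i) * inner ℂ (b i) x)]
    simp only [mul_comm]
  simp only [h]
  exact ((innerSL ℂ y).continuous.tendsto _).comp (tendsto_basisProj b x) |>.const_sub 1

/-- The affine dependence on `z` passes to the limit from finite sections, and holds whether or not
`1 - T` is invertible. -/
theorem fredholmDet_add_smul_rankOne [CompleteSpace E]
    {T : E →L[ℂ] E} {r : ℝ} (hT : NuclearNormLE T r)
    (b : HilbertBasis ι ℂ E) (x y : E) (z : ℂ) :
    fredholmDet b (T + z • InnerProductSpace.rankOne ℂ x y) = fredholmDet b T +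
      z * (fredholmDet b (T + InnerProductSpace.rankOne ℂ x y) - fredholmDet b T) := by
  classical
  have hR := NuclearNormLE.rankOne x y
  refine tendsto_nhds_unique ((hT.add (hR.smul z)).tendsto_sectionDet b) ?_
  have h : ∀ F, sectionDet b F (T + z • InnerProductSpace.rankOne ℂ x y) = sectionDet b F T +
      z * (sectionDet b F (T + InnerProductSpace.rankOne ℂ x y) - sectionDet b F T) := by
    intro F
    simp only [sectionDet, sectionMatrix_add, sectionMatrix_smul, sectionMatrix_rankOne,
      ← sub_sub]
    exact Matrix.det_sub_smul_vecMulVec _ _ _ _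
  simp only [h]
  exact (hT.tendsto_sectionDet b).add
    ((((hT.add hR).tendsto_sectionDet b).sub (hT.tendsto_sectionDet b)).const_mul z)

/-- With `V = (1 - T)⁻¹` one has `V = 1 + T * V`, again of the form `1` minus a nuclear operator, so
multiplicativity gives a product equal to `1`. -/
theorem fredholmDet_ne_zero [CompleteSpace E] {T : E →L[ℂ] E} {r : ℝ} (hT : NuclearNormLE T r)
    (hu : IsUnit (1 - T)) (b : HilbertBasis ι ℂ E) : fredholmDet b T ≠ 0 := by
  obtain ⟨V, hV, -⟩ := isUnit_iff_exists.mp hu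
  have hS : NuclearNormLE (-(T * V)) (r * ‖V‖) := (hT.comp_right V).neg
  have h1 := fredholmDet_mul hT hS b
  have h2 : T + -(T * V) - T * -(T * V) = 0 := by
    have : T * ((1 - T) * V) = T := by rw [hV, mul_one]
    calc T + -(T * V) - T * -(T * V) = T - T * ((1 - T) * V) := by noncomm_ring
      _ = 0 := by rw [this, sub_self]
  rw [h2, fredholmDet_zero] at h1
  exact left_ne_zero_of_mul_eq_one h1

/-- Multiplicativity applied to `1 - T - R = (1 - T) (1 - (1 - T)⁻¹ R)`, whose second factor is a
rank one perturbation of `1`. -/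
theorem fredholmDet_add_rankOne [CompleteSpace E] {T : E →L[ℂ] E} {r : ℝ} (hT : NuclearNormLE T r)
    (hu : IsUnit (1 - T)) (b : HilbertBasis ι ℂ E) (x y : E) :
    fredholmDet b (T + InnerProductSpace.rankOne ℂ x y) =
      fredholmDet b T * (1 - inner ℂ y (Ring.inverse (1 - T) x)) := by
  rw [← fredholmDet_rankOne b, fredholmDet_mul hT (NuclearNormLE.rankOne _ _)]
  congr 1
  have h1 : InnerProductSpace.rankOne ℂ (Ring.inverse (1 - T) x) y =
      Ring.inverse (1 - T) * InnerProductSpace.rankOne ℂ x y := by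
    ext z
    simp
  calc T + InnerProductSpace.rankOne ℂ x y
      = T + (1 - T) * Ring.inverse (1 - T) * InnerProductSpace.rankOne ℂ x y := by
        rw [Ring.mul_inverse_cancel _ hu, one_mul]
    _ = _ := by rw [h1]; noncomm_ring

end Fredholm

/-! ### Multiplication operators on `L²` -/

section Multiplication

variable {α : Type*} [MeasurableSpace α] {μ : Measure α}

open Classical in
/-- Multiplication by a bounded function, as an operator on `L²`. -/
def mulLp (μ : Measure α) (w : α → ℂ) : Lp ℂ 2 μ →L[ℂ] Lp ℂ 2 μ :=
  if h : MemLp w ∞ μ then (ContinuousLinearMap.mul ℂ ℂ).holderL μ ∞ 2 2 (h.toLp w) else 0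

theorem coeFn_mulLp {w : α → ℂ} (h : MemLp w ∞ μ) (φ : Lp ℂ 2 μ) :
    mulLp μ w φ =ᵐ[μ] fun u => w u * φ u := by
  rw [mulLp, dif_pos h]
  filter_upwards [(ContinuousLinearMap.mul ℂ ℂ).coeFn_holder (r := 2) (h.toLp w) φ, h.coeFn_toLp]
    with u h1 h2
  refine Eq.trans h1 ?_
  rw [h2]
  rfl

theorem norm_mulLp_le {w : α → ℂ} (h : AEStronglyMeasurable w μ) {C : ℝ} (hC : ∀ u, ‖w u‖ ≤ C)
    (hC0 : 0 ≤ C) : ‖mulLp μ w‖ ≤ C := by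
  refine ContinuousLinearMap.opNorm_le_bound _ hC0 fun φ => ?_
  refine Lp.norm_le_mul_norm_of_ae_le_mul ?_
  filter_upwards [coeFn_mulLp (memLp_top_of_bound h C (Eventually.of_forall hC)) φ] with u hu
  rw [hu, norm_mul]
  exact mul_le_mul_of_nonneg_right (hC u) (norm_nonneg _)

theorem mulLp_mul_mulLp {w₁ w₂ : α → ℂ} (h₁ : MemLp w₁ ∞ μ) (h₂ : MemLp w₂ ∞ μ) :
    mulLp μ w₁ * mulLp μ w₂ = mulLp μ (fun u => w₁ u * w₂ u) := by
  have h : MemLp (fun u => w₁ u * w₂ u) ∞ μ := h₂.mul h₁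
  ext φ
  filter_upwards [coeFn_mulLp h₁ (mulLp μ w₂ φ), coeFn_mulLp h₂ φ, coeFn_mulLp h φ] with u e1 e2 e3
  rw [e3, mul_assoc, ← e2, ← e1]
  rfl

theorem tendsto_mulLp {w : ℕ → α → ℂ} (hm : ∀ n, AEStronglyMeasurable (w n) μ)
    (hb : ∀ n u, ‖w n u‖ ≤ 1) (ht : ∀ᵐ u ∂μ, Tendsto (fun n => w n u) atTop (𝓝 1))
    (φ : Lp ℂ 2 μ) : Tendsto (fun n => mulLp μ (w n) φ) atTop (𝓝 φ) := by
  have hL : ∀ n, MemLp (w n) ∞ μ := fun n =>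
    memLp_top_of_bound (hm n) 1 (Eventually.of_forall (hb n))
  rw [Lp.tendsto_Lp_iff_tendsto_eLpNorm']
  have h2 : ∀ n, eLpNorm (⇑(mulLp μ (w n) φ) - ⇑φ) 2 μ =
      (∫⁻ u, ‖(w n u - 1) * φ u‖ₑ ^ (2 : ℝ) ∂μ) ^ (1 / 2 : ℝ) := by
    intro n
    rw [eLpNorm_eq_lintegral_rpow_enorm_toReal two_ne_zero ENNReal.ofNat_ne_top]
    simp only [ENNReal.toReal_ofNat]
    congr 1
    refine lintegral_congr_ae ?_
    filter_upwards [coeFn_mulLp (hL n) φ] with u hu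
    rw [Pi.sub_apply, hu, sub_mul, one_mul]
  simp only [h2]
  have h3 : Tendsto (fun n => ∫⁻ u, ‖(w n u - 1) * φ u‖ₑ ^ (2 : ℝ) ∂μ) atTop
      (𝓝 (∫⁻ _, 0 ∂μ)) := by
    refine tendsto_lintegral_of_dominated_convergence' (fun u => ‖2 * φ u‖ₑ ^ (2 : ℝ))
      (fun n => ?_) (fun n => Eventually.of_forall fun u => ?_) ?_ ?_
    · exact ((((hm n).sub aestronglyMeasurable_const).mul
        (Lp.aestronglyMeasurable φ)).enorm).pow_const _
    · refine ENNReal.rpow_le_rpow ?_ zero_le_two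
      rw [enorm_le_iff_norm_le, norm_mul, norm_mul]
      refine mul_le_mul_of_nonneg_right ((norm_sub_le _ _).trans ?_) (norm_nonneg _)
      have := hb n u
      norm_num
      linarith
    · have := (Lp.memLp φ).const_mul 2
      exact (lintegral_rpow_enorm_lt_top_of_eLpNorm_lt_top two_ne_zero ENNReal.ofNat_ne_top
        this.eLpNorm_lt_top).ne
    · filter_upwards [ht] with u hu
      have h4 : Tendsto (fun n => (w n u - 1) * φ u) atTop (𝓝 0) := by
        simpa using (hu.sub_const 1).mul_const (φ u)
      have h5 := ((ENNReal.continuous_rpow_const (y := 2)).tendsto _).comp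
        ((continuous_enorm.tendsto _).comp h4)
      simpa [Function.comp_def] using h5
  rw [lintegral_zero] at h3
  have := ((ENNReal.continuous_rpow_const (y := 1 / 2)).tendsto _).comp h3
  simpa [Function.comp_def] using this

end Multiplication

/-! ### Measurability of contours and the sets `Ω` -/

namespace SimpleContour

theorem measurableSet_dom (C : SimpleContour) : MeasurableSet C.dom := by
  rcases C.infinite_or_closed with h | ⟨L, -, h, -⟩
  · rw [h.1]
    exact MeasurableSet.univ
  · rw [h]
    exact measurableSet_Ico

/-- By the Lusin-Souslin theorem: an injective continuous image of a Borel set is Borel. -/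
theorem measurableSet_carrier (C : SimpleContour) : MeasurableSet C.carrier :=
  C.measurableSet_dom.image_of_continuousOn_injOn C.lipschitz.continuous.continuousOn C.injOn

theorem ae_mem_carrier (C : SimpleContour) : ∀ᵐ u ∂C.arcLength, u ∈ C.carrier := by
  refine (ae_map_iff C.lipschitz.continuous.aemeasurable C.measurableSet_carrier).mpr ?_
  filter_upwards [ae_restrict_mem C.measurableSet_dom] with s hs
  exact Set.mem_image_of_mem _ hs

theorem measurable_tangent (C : SimpleContour) : Measurable C.tangent :=
  (C.lipschitz.continuous.continuousOn.measurableEmbedding C.measurableSet_dom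
    C.injOn).measurable_extend ((measurable_deriv C.γ).comp measurable_subtype_coe)
    measurable_const

theorem norm_tangent_le (C : SimpleContour) (u : ℂ) : ‖C.tangent u‖ ≤ 1 := by
  by_cases h : ∃ s : C.dom, C.γ s = u
  · obtain ⟨s, rfl⟩ := h
    have : Function.Injective fun s : C.dom => C.γ s := fun s t h => Subtype.ext (C.injOn s.2 t.2 h)
    rw [tangent, this.extend_apply]
    simpa using norm_deriv_le_of_lipschitz C.lipschitz (x₀ := (s : ℝ))
  · rw [tangent, Function.extend_apply' _ _ _ h]
    simp

end SimpleContour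

namespace SpectralSet

theorem ae_mem_carrier (X : SpectralSet) : ∀ᵐ u ∂X.absMeasure, u ∈ X.carrier := by
  cases X with
  | discrete Ω h =>
    have : IsClosed Ω := by
      rw [isClosed_iff_derivedSet_subset]
      intro z hz
      exact absurd hz (h z)
    exact ae_restrict_mem this.measurableSet
  | contours n C h =>
    rw [absMeasure, ← Measure.sum_fintype, Measure.ae_sum_iff]
    intro k
    filter_upwards [(C k).ae_mem_carrier] with u hu
    exact Set.mem_iUnion.mpr ⟨k, hu⟩

theorem measurable_density (X : SpectralSet) : Measurable X.density := by
  cases X with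
  | discrete Ω h => exact measurable_const
  | contours n C h =>
    rw [density, show ∑ k, (C k).tangent = fun u => ∑ k, (C k).tangent u from
      funext fun u => Finset.sum_apply u _ _]
    exact Finset.measurable_sum _ fun k _ => (C k).measurable_tangent

theorem exists_norm_density_le (X : SpectralSet) : ∃ B : ℝ, ∀ u, ‖X.density u‖ ≤ B := by
  cases X with
  | discrete Ω h => exact ⟨1, fun u => by simp [density]⟩
  | contours n C h =>
    refine ⟨n, fun u => ?_⟩
    rw [density, Finset.sum_apply]
    refine (norm_sum_le _ _).trans ?_
    refine (Finset.sum_le_sum fun k _ => (C k).norm_tangent_le u).trans ?_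
    simp

theorem memLp_density (X : SpectralSet) : MemLp X.density ∞ X.absMeasure := by
  obtain ⟨B, hB⟩ := X.exists_norm_density_le
  exact memLp_top_of_bound X.measurable_density.aestronglyMeasurable B (Eventually.of_forall hB)

end SpectralSet

/-! ### Integral operators and conjugation of their kernels -/

namespace SpectralSet

variable (X : SpectralSet)

/-- The vector `b` with `⟨b, φ⟩ = ∫_Ω φ g dμ`. -/
def dualVec {g : ℂ → ℂ} (hg : MemLp g 2 X.absMeasure) : X.Hilb :=
  (X.memLp_density.mul hg : MemLp (fun u => g u * X.density u) 2 X.absMeasure).star.toLp _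

theorem inner_dualVec {g : ℂ → ℂ} (hg : MemLp g 2 X.absMeasure) (φ : X.Hilb) :
    inner ℂ (X.dualVec hg) φ = X.integral fun v => g v * φ v := by
  rw [L2.inner_def, integral]
  refine integral_congr_ae ?_
  have h := (X.memLp_density.mul hg : MemLp (fun u => g u * X.density u) 2 X.absMeasure).star
  filter_upwards [h.coeFn_toLp] with u hu
  rw [dualVec, hu]
  simp
  ring

theorem integrable_mul_density {g : ℂ → ℂ} (hg : MemLp g 2 X.absMeasure) (φ : X.Hilb) :
    Integrable (fun v => g v * φ v * X.density v) X.absMeasure := by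
  have h1 : MemLp (fun v => g v * X.density v) 2 X.absMeasure := X.memLp_density.mul hg
  have h2 : MemLp (fun v => (g v * X.density v) * φ v) 1 X.absMeasure := (Lp.memLp φ).mul h1
  refine (memLp_one_iff_integrable.mp h2).congr (Eventually.of_forall fun v => ?_)
  simp only
  ring

namespace IsIntegralOperator

variable {X} {T S : X.Hilb →L[ℂ] X.Hilb} {k l : ℂ → ℂ → ℂ}

theorem rankOne {f g : ℂ → ℂ} (hf : MemLp f 2 X.absMeasure) (hg : MemLp g 2 X.absMeasure) :
    X.IsIntegralOperator (InnerProductSpace.rankOne ℂ (hf.toLp f) (X.dualVec hg))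
      fun u v => f u * g v := by
  intro φ
  rw [InnerProductSpace.rankOne_apply, inner_dualVec]
  filter_upwards [Lp.coeFn_smul (X.integral fun v => g v * φ v) (hf.toLp f), hf.coeFn_toLp]
    with u h1 h2
  constructor
  · simpa only [mul_assoc] using (X.integrable_mul_density hg φ).const_mul (f u)
  · rw [h1, Pi.smul_apply, h2, smul_eq_mul, mul_comm]
    simp only [integral, mul_assoc, integral_const_mul]

theorem add (hT : X.IsIntegralOperator T k) (hS : X.IsIntegralOperator S l) :
    X.IsIntegralOperator (T + S) fun u v => k u v + l u v := by
  intro φ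
  filter_upwards [hT φ, hS φ, Lp.coeFn_add (T φ) (S φ)] with u h1 h2 h3
  have h4 : (fun v => (k u v + l u v) * φ v * X.density v) =
      fun v => k u v * φ v * X.density v + l u v * φ v * X.density v := by
    ext v
    ring
  constructor
  · rw [h4]
    exact h1.1.add h2.1
  · rw [_root_.add_apply, h3, Pi.add_apply, h1.2, h2.2, integral, integral, integral,
      h4, integral_add h1.1 h2.1]

theorem smul (c : ℂ) (hT : X.IsIntegralOperator T k) :
    X.IsIntegralOperator (c • T) fun u v => c * k u v := by
  intro φ
  filter_upwards [hT φ, Lp.coeFn_smul c (T φ)] with u h1 h2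
  constructor
  · simpa only [mul_assoc] using h1.1.const_mul c
  · rw [_root_.smul_apply, h2, Pi.smul_apply, h1.2, smul_eq_mul]
    simp only [integral, mul_assoc, integral_const_mul]

theorem sub (hT : X.IsIntegralOperator T k) (hS : X.IsIntegralOperator S l) :
    X.IsIntegralOperator (T - S) fun u v => k u v - l u v := by
  simpa [sub_eq_add_neg] using hT.add (hS.smul (-1))

theorem zero : X.IsIntegralOperator 0 fun _ _ => 0 := by
  intro φ
  filter_upwards [Lp.coeFn_zero ℂ 2 X.absMeasure] with u hu
  rw [_root_.zero_apply, hu]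
  simp [integral]

theorem sum {T : ℕ → X.Hilb →L[ℂ] X.Hilb} {k : ℕ → ℂ → ℂ → ℂ}
    (h : ∀ n, X.IsIntegralOperator (T n) (k n)) (N : ℕ) :
    X.IsIntegralOperator (∑ n ∈ Finset.range N, T n) fun u v => ∑ n ∈ Finset.range N, k n u v := by
  induction N with
  | zero => simpa using zero
  | succ N ih =>
    simp only [Finset.sum_range_succ]
    exact ih.add (h N)

theorem mulLp_mul (hT : X.IsIntegralOperator T k) {w : ℂ → ℂ} (hw : MemLp w ∞ X.absMeasure) :
    X.IsIntegralOperator (mulLp X.absMeasure w * T) fun u v => w u * k u v := by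
  intro φ
  filter_upwards [hT φ, coeFn_mulLp hw (T φ)] with u h1 h2
  constructor
  · simpa only [mul_assoc] using h1.1.const_mul (w u)
  · refine h2.trans ?_
    rw [h1.2]
    simp only [integral, mul_assoc, integral_const_mul]

theorem mul_mulLp (hT : X.IsIntegralOperator T k) {w : ℂ → ℂ} (hw : MemLp w ∞ X.absMeasure) :
    X.IsIntegralOperator (T * mulLp X.absMeasure w) fun u v => k u v * w v := by
  intro φ
  filter_upwards [hT (mulLp X.absMeasure w φ)] with u h1
  have h2 : (fun v => k u v * mulLp X.absMeasure w φ v * X.density v) =ᵐ[X.absMeasure]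
      fun v => k u v * w v * φ v * X.density v := by
    filter_upwards [coeFn_mulLp hw φ] with v hv
    rw [hv]
    ring
  exact ⟨h1.1.congr h2, h1.2.trans (integral_congr_ae h2)⟩

theorem eq_of_kernel_eq (hT : X.IsIntegralOperator T k) (hS : X.IsIntegralOperator S l)
    (h : ∀ u ∈ X.carrier, ∀ v ∈ X.carrier, k u v = l u v) : T = S := by
  ext φ
  filter_upwards [hT φ, hS φ, X.ae_mem_carrier] with u h1 h2 hu
  rw [h1.2, h2.2]
  refine integral_congr_ae ?_
  filter_upwards [X.ae_mem_carrier] with v hv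
  simp only [h u hu v hv]

theorem congr_kernel (hT : X.IsIntegralOperator T k) (h : ∀ u v, k u v = l u v) :
    X.IsIntegralOperator T l := by
  rwa [← (funext fun u => funext fun v => h u v : k = l)]

/-- A subsequence of `T n φ` converges almost everywhere, and dominated convergence in `v`
identifies its limit. The domination is for fixed `u`, so nothing is required of `A`. -/
theorem of_tendsto {T : ℕ → X.Hilb →L[ℂ] X.Hilb} {k : ℕ → ℂ → ℂ → ℂ}
    {S : X.Hilb →L[ℂ] X.Hilb} {l : ℂ → ℂ → ℂ} (h : ∀ n, X.IsIntegralOperator (T n) (k n))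
    (hT : ∀ φ, Tendsto (fun n => T n φ) atTop (𝓝 (S φ)))
    (hk : ∀ u v, Tendsto (fun n => k n u v) atTop (𝓝 (l u v))) {A : ℂ → ℝ} {B : ℂ → ℂ}
    (hB : MemLp B 2 X.absMeasure) (hkAB : ∀ n u v, ‖k n u v‖ ≤ A u * ‖B v‖) :
    X.IsIntegralOperator S l := by
  intro φ
  obtain ⟨ns, hns, hsub⟩ := (tendstoInMeasure_of_tendsto_Lp (hT φ)).exists_seq_tendsto_ae
  filter_upwards [ae_all_iff.mpr fun n => h n φ, hsub] with u h1 h2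
  have hdom : Integrable (fun v => A u * ‖B v * φ v * X.density v‖) X.absMeasure :=
    (X.integrable_mul_density hB φ).norm.const_mul _
  have hle : ∀ n v, ‖k n u v * φ v * X.density v‖ ≤ A u * ‖B v * φ v * X.density v‖ := by
    intro n v
    simp only [norm_mul, ← mul_assoc]
    gcongr
    exact hkAB n u v
  have hlim : ∀ v, Tendsto (fun n => k n u v * φ v * X.density v) atTop
      (𝓝 (l u v * φ v * X.density v)) := fun v => ((hk u v).mul_const _).mul_const _
  have hconv := tendsto_integral_of_dominated_convergence _ (fun n => (h1 n).1.1) hdom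
    (fun n => Eventually.of_forall (hle n)) (Eventually.of_forall hlim)
  constructor
  · refine hdom.mono' (aestronglyMeasurable_of_tendsto_ae atTop (fun n => (h1 n).1.1)
      (Eventually.of_forall hlim)) (Eventually.of_forall fun v => ?_)
    exact le_of_tendsto (hlim v).norm (Eventually.of_forall fun n => hle n v)
  · refine tendsto_nhds_unique h2 ?_
    have := hconv.comp hns.tendsto_atTop
    refine this.congr fun n => ?_
    exact (h1 (ns n)).2.symm

end IsIntegralOperator

/-- The cut-off function of the annulus `1 / n ≤ |z| ≤ n`. -/
def annulusCutoff (n : ℕ) (z : ℂ) : ℂ := Set.indicator {z : ℂ | ‖z‖ ≤ n ∧ 1 ≤ n * ‖z‖} 1 z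

theorem measurable_annulusCutoff (n : ℕ) : Measurable (annulusCutoff n) := by
  refine measurable_const.indicator ?_
  exact (measurableSet_le measurable_norm measurable_const).inter
    (measurableSet_le measurable_const (measurable_norm.const_mul _))

theorem norm_annulusCutoff_le (n : ℕ) (z : ℂ) : ‖annulusCutoff n z‖ ≤ 1 := by
  rw [annulusCutoff, Set.indicator_apply]
  split_ifs <;> simp

theorem annulusCutoff_mul_self (n : ℕ) (z : ℂ) :
    annulusCutoff n z * annulusCutoff n z = annulusCutoff n z := by
  rw [annulusCutoff, Set.indicator_apply]
  split_ifs <;> simp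

theorem norm_annulusCutoff_mul_le (n : ℕ) (z : ℂ) : ‖annulusCutoff n z * z‖ ≤ n := by
  rw [annulusCutoff, Set.indicator_apply]
  split_ifs with h
  · simpa using h.1
  · simp

theorem norm_annulusCutoff_mul_inv_le (n : ℕ) (z : ℂ) : ‖annulusCutoff n z * z⁻¹‖ ≤ n := by
  rw [annulusCutoff, Set.indicator_apply]
  split_ifs with h
  · have hz : 0 < ‖z‖ := by
      by_contra hz
      have : ‖z‖ = 0 := le_antisymm (not_lt.mp hz) (norm_nonneg z)
      have h2 := h.2
      rw [this] at h2
      norm_num at h2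
    simpa [inv_le_iff_one_le_mul₀ hz] using h.2
  · simp

theorem annulusCutoff_mul_inv_mul_mul (n : ℕ) (z : ℂ) :
    annulusCutoff n z * z⁻¹ * (annulusCutoff n z * z) = annulusCutoff n z := by
  rcases eq_or_ne z 0 with rfl | hz
  · simp [annulusCutoff]
  · rw [mul_mul_mul_comm, annulusCutoff_mul_self, inv_mul_cancel₀ hz, mul_one]

theorem tendsto_annulusCutoff {z : ℂ} (hz : z ≠ 0) :
    Tendsto (fun n => annulusCutoff n z) atTop (𝓝 1) := by
  have hz' : 0 < ‖z‖ := norm_pos_iff.mpr hz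
  refine tendsto_const_nhds.congr' ?_
  filter_upwards [tendsto_natCast_atTop_atTop.eventually_ge_atTop ‖z‖,
    tendsto_natCast_atTop_atTop.eventually_ge_atTop ‖z‖⁻¹] with n h1 h2
  rw [annulusCutoff, Set.indicator_of_mem]
  · rfl
  · exact ⟨h1, (inv_le_iff_one_le_mul₀ hz').mp h2⟩

/-- Conjugation of the kernel by a nowhere vanishing function, which need not be bounded, does not
change the Fredholm determinant. -/
theorem fredholmDet_eq_of_kernel_conj {X : SpectralSet} {T S : X.Hilb →L[ℂ] X.Hilb}
    {k l : ℂ → ℂ → ℂ} (hT : X.IsIntegralOperator T k) (hS : X.IsIntegralOperator S l) {r s : ℝ}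
    (hTr : NuclearNormLE T r) (hSs : NuclearNormLE S s) {c : ℂ → ℂ}
    (hc : AEStronglyMeasurable c X.absMeasure) (hc0 : ∀ u ∈ X.carrier, c u ≠ 0)
    (h : ∀ u ∈ X.carrier, ∀ v ∈ X.carrier, l u v = c u * k u v * (c v)⁻¹)
    {ι : Type*} (b : HilbertBasis ι ℂ X.Hilb) : fredholmDet b T = fredholmDet b S := by
  set P : ℕ → X.Hilb →L[ℂ] X.Hilb := fun n => mulLp X.absMeasure fun u => annulusCutoff n (c u)
  have hm : ∀ n, AEStronglyMeasurable (fun u => annulusCutoff n (c u)) X.absMeasure := fun n =>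
    ((measurable_annulusCutoff n).comp_aemeasurable hc.aemeasurable).aestronglyMeasurable
  have hP1 : ∀ n, MemLp (fun u => annulusCutoff n (c u)) ∞ X.absMeasure := fun n =>
    memLp_top_of_bound (hm n) 1 (Eventually.of_forall fun u => norm_annulusCutoff_le n _)
  have hC1 : ∀ n, MemLp (fun u => annulusCutoff n (c u) * c u) ∞ X.absMeasure := fun n =>
    memLp_top_of_bound ((hm n).mul hc) n
      (Eventually.of_forall fun u => norm_annulusCutoff_mul_le n _)
  have hD1 : ∀ n, MemLp (fun u => annulusCutoff n (c u) * (c u)⁻¹) ∞ X.absMeasure := fun n =>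
    memLp_top_of_bound ((hm n).mul hc.aemeasurable.inv.aestronglyMeasurable) n
      (Eventually.of_forall fun u => norm_annulusCutoff_mul_inv_le n _)
  have hPt : ∀ φ, Tendsto (fun n => P n φ) atTop (𝓝 φ) := fun φ => by
    refine tendsto_mulLp hm (fun n u => norm_annulusCutoff_le n _) ?_ φ
    filter_upwards [X.ae_mem_carrier] with u hu
    exact tendsto_annulusCutoff (hc0 u hu)
  have hPn : ∀ n, ‖P n‖ ≤ 1 := fun n =>
    norm_mulLp_le (hm n) (fun u => norm_annulusCutoff_le n _) zero_le_one
  have hPP : ∀ n, P n * P n = P n := fun n => by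
    simp only [P, mulLp_mul_mulLp (hP1 n) (hP1 n), annulusCutoff_mul_self]
  have hDC : ∀ n, mulLp X.absMeasure (fun u => annulusCutoff n (c u) * (c u)⁻¹) *
      mulLp X.absMeasure (fun u => annulusCutoff n (c u) * c u) = P n := fun n => by
    simp only [P, mulLp_mul_mulLp (hD1 n) (hC1 n), annulusCutoff_mul_inv_mul_mul]
  -- Where the cut-off is nonzero, `c` and `c⁻¹` are bounded by `n`, so the conjugation is by
  -- bounded operators.
  have hconj : ∀ n, P n * S * P n = mulLp X.absMeasure (fun u => annulusCutoff n (c u) * c u) * T *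
      mulLp X.absMeasure (fun u => annulusCutoff n (c u) * (c u)⁻¹) := fun n => by
    refine ((hS.mulLp_mul (hP1 n)).mul_mulLp (hP1 n)).eq_of_kernel_eq
      ((hT.mulLp_mul (hC1 n)).mul_mulLp (hD1 n)) fun u hu v hv => ?_
    rw [h u hu v hv]
    ring
  -- With `C`, `D` the multiplications by the truncated `c`, `c⁻¹`, cyclicity gives `det (1 - P S) =
  -- det (1 - P S P) = det (1 - C T D) = det (1 - D C T)`, and `D C = P`.
  have heq : ∀ n, fredholmDet b (P n * S) = fredholmDet b (P n * T) := fun n => by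
    have h1 := fredholmDet_mul_comm (hSs.comp_left (P n)) (P n) b
    rw [hconj n, ← mul_assoc, hPP] at h1
    rw [← h1, fredholmDet_mul_comm (hTr.comp_left _), ← mul_assoc, hDC]
  refine tendsto_nhds_unique ((hTr.tendsto_mul hPn hPt).tendsto_fredholmDet hTr b) ?_
  simp only [← heq]
  exact (hSs.tendsto_mul hPn hPt).tendsto_fredholmDet hSs b

end SpectralSet

/-! ### The divided exponential kernel as a series of commutators -/

section DividedExponential

/-- The divided difference `(exp (h z) - 1) / z` of the exponential function. -/
def divExp (h z : ℂ) : ℂ := if z = 0 then h else (Complex.exp (h * z) - 1) / z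

theorem hasSum_divExp (h z : ℂ) :
    HasSum (fun n : ℕ => h ^ (n + 1) / (n + 1).factorial * z ^ n) (divExp h z) := by
  rcases eq_or_ne z 0 with rfl | hz
  · have := hasSum_single (f := fun n : ℕ => h ^ (n + 1) / (n + 1).factorial * (0 : ℂ) ^ n) 0
      (fun n hn => by simp [hn])
    simpa [divExp] using this
  · have h1 : HasSum (fun n : ℕ => (h * z) ^ n / n.factorial) (Complex.exp (h * z)) := by
      rw [Complex.exp_eq_exp_ℂ]
      exact NormedSpace.expSeries_div_hasSum_exp (h * z)
    have h2 := (hasSum_nat_add_iff' 1).mpr h1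
    simp only [Finset.range_one, Finset.sum_singleton, pow_zero, Nat.factorial_zero, Nat.cast_one,
      div_one] at h2
    have h3 := h2.div_const z
    rw [divExp, if_neg hz]
    have h4 : (fun n : ℕ => h ^ (n + 1) / ((n + 1).factorial : ℂ) * z ^ n) =
        fun n : ℕ => (h * z) ^ (n + 1) / ((n + 1).factorial : ℂ) / z := by
      ext n
      rw [mul_pow, pow_succ z]
      field_simp
    rw [h4]
    exact h3

theorem hasSum_exp_sub_one (x : ℝ) :
    HasSum (fun n : ℕ => x ^ (n + 1) / (n + 1).factorial) (Real.exp x - 1) := by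
  have h1 : HasSum (fun n : ℕ => x ^ n / n.factorial) (Real.exp x) := by
    rw [Real.exp_eq_exp_ℝ]
    exact NormedSpace.expSeries_div_hasSum_exp x
  simpa using (hasSum_nat_add_iff' 1).mpr h1

variable {E : Type*} [NormedAddCommGroup E] [InnerProductSpace ℂ E] [CompleteSpace E]

/-- The iterated commutator `[M, [M, …, [M, T]]]`. -/
def iterCommutator (M T : E →L[ℂ] E) : ℕ → E →L[ℂ] E
  | 0 => T
  | n + 1 => M * iterCommutator M T n - iterCommutator M T n * M

theorem NuclearNormLE.iterCommutator {M T : E →L[ℂ] E} {r R : ℝ} (hT : NuclearNormLE T r)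
    (hM : ‖M‖ ≤ R) (n : ℕ) : NuclearNormLE (iterCommutator M T n) ((2 * R) ^ n * r) := by
  induction n with
  | zero => simpa [_root_.iterCommutator] using hT
  | succ n ih =>
    refine ((ih.comp_left M).sub (ih.comp_right M)).mono ?_
    have h1 := mul_le_mul_of_nonneg_right hM ih.nonneg
    rw [pow_succ]
    linarith

theorem norm_iterCommutator_le {M T : E →L[ℂ] E} {R : ℝ} (hM : ‖M‖ ≤ R) (n : ℕ) :
    ‖iterCommutator M T n‖ ≤ (2 * R) ^ n * ‖T‖ := by
  induction n with
  | zero => simp [iterCommutator]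
  | succ n ih =>
    refine (norm_sub_le _ _).trans ?_
    have h1 := (norm_mul_le M (iterCommutator M T n)).trans
      (mul_le_mul hM ih (norm_nonneg _) ((norm_nonneg M).trans hM))
    have h2 := (norm_mul_le (iterCommutator M T n) M).trans
      (mul_le_mul ih hM (norm_nonneg _) ((norm_nonneg _).trans ih))
    rw [pow_succ]
    linarith

theorem norm_pow_succ_div_factorial_mul_le (h : ℂ) {R : ℝ} (hR : 0 ≤ R) (n : ℕ) :
    ‖h ^ (n + 1) / ((n + 1).factorial : ℂ)‖ * R ^ n ≤ ‖h‖ * ((R * ‖h‖) ^ n / n.factorial) := by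
  rw [norm_div, norm_pow, Complex.norm_natCast, mul_pow, pow_succ]
  calc ‖h‖ ^ n * ‖h‖ / ((n + 1).factorial : ℝ) * R ^ n
      ≤ ‖h‖ ^ n * ‖h‖ / (n.factorial : ℝ) * R ^ n := by
        gcongr
        exact Nat.le_succ n
    _ = _ := by ring

/-- The operator `∑ₙ hⁿ⁺¹ / (n + 1)! adₘⁿ T`. -/
theorem exists_hasSum_iterCommutator {M T : E →L[ℂ] E} {r R : ℝ} (hT : NuclearNormLE T r)
    (hM : ‖M‖ ≤ R) (h : ℂ) : ∃ W : E →L[ℂ] E,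
      HasSum (fun n : ℕ => (h ^ (n + 1) / ((n + 1).factorial : ℂ)) • iterCommutator M T n) W ∧
      NuclearNormLE (W - h • T) (‖h‖ * (Real.exp (2 * R * ‖h‖) - 1) * r) := by
  have hR : 0 ≤ 2 * R := by linarith [(norm_nonneg M).trans hM]
  have hs : Summable fun n : ℕ =>
      (h ^ (n + 1) / ((n + 1).factorial : ℂ)) • iterCommutator M T n := by
    refine Summable.of_norm_bounded (((Real.summable_pow_div_factorial (2 * R * ‖h‖)).mul_left
      ‖h‖).mul_right ‖T‖) fun n => ?_
    rw [norm_smul]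
    calc _ ≤ ‖h ^ (n + 1) / ((n + 1).factorial : ℂ)‖ * ((2 * R) ^ n * ‖T‖) := by
          gcongr
          exact norm_iterCommutator_le hM n
      _ ≤ _ := by
          rw [← mul_assoc]
          exact mul_le_mul_of_nonneg_right (norm_pow_succ_div_factorial_mul_le h hR n)
            (norm_nonneg _)
  obtain ⟨W, hW⟩ := hs
  refine ⟨W, hW, ?_⟩
  -- The term `n = 0` is `h • T`. The others have total nuclear norm at most `‖h‖ (exp (2 R ‖h‖) -
  -- 1) r`, which is of second order in `h`.
  have h1 := (hasSum_nat_add_iff' 1).mpr hW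
  simp only [Finset.range_one, Finset.sum_singleton, zero_add, pow_one, Nat.factorial_one,
    Nat.cast_one, div_one, iterCommutator] at h1
  refine NuclearNormLE.of_hasSum (κ := ℕ)
    (fun n => ((hT.iterCommutator hM (n + 1)).smul _).mono ?_)
    (((hasSum_exp_sub_one (2 * R * ‖h‖)).mul_left ‖h‖).mul_right r)
    (fun x => (ContinuousLinearMap.apply ℂ E x).hasSum h1)
  rw [← mul_assoc]
  exact mul_le_mul_of_nonneg_right (norm_pow_succ_div_factorial_mul_le h hR (n + 1)) hT.nonneg

end DividedExponential

namespace SpectralSet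

variable {X : SpectralSet}

/-- Each commutator with multiplication by `w` multiplies the kernel by `w u - w v`, so power series
in this difference become series of iterated commutators. -/
theorem IsIntegralOperator.iterCommutator {T : X.Hilb →L[ℂ] X.Hilb} {k : ℂ → ℂ → ℂ}
    (hT : X.IsIntegralOperator T k) {w : ℂ → ℂ} (hw : MemLp w ∞ X.absMeasure) (n : ℕ) :
    X.IsIntegralOperator (iterCommutator (mulLp X.absMeasure w) T n)
      fun u v => (w u - w v) ^ n * k u v := by
  induction n with
  | zero => simpa [_root_.iterCommutator] using hT
  | succ n ih =>
    refine ((ih.mulLp_mul hw).sub (ih.mul_mulLp hw)).congr_kernel fun u v => ?_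
    ring

/-- The integral operator with kernel `(exp (h (w u - w v)) - 1) / (w u - w v) f(u) g(v)`. -/
theorem exists_isIntegralOperator_divExp {f g w : ℂ → ℂ} (hf : MemLp f 2 X.absMeasure)
    (hg : MemLp g 2 X.absMeasure) (hw : AEStronglyMeasurable w X.absMeasure) {R : ℝ}
    (hR : ∀ u, ‖w u‖ ≤ R) (h : ℂ) : ∃ W : X.Hilb →L[ℂ] X.Hilb,
      X.IsIntegralOperator W (fun u v => divExp h (w u - w v) * (f u * g v)) ∧
      NuclearNormLE (W - h • InnerProductSpace.rankOne ℂ (hf.toLp f) (X.dualVec hg))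
        (‖h‖ * (Real.exp (2 * R * ‖h‖) - 1) * (‖hf.toLp f‖ * ‖X.dualVec hg‖)) := by
  have hR0 : 0 ≤ R := (norm_nonneg _).trans (hR 0)
  obtain ⟨W, hW, hWn⟩ := exists_hasSum_iterCommutator
    (NuclearNormLE.rankOne (hf.toLp f) (X.dualVec hg)) (norm_mulLp_le hw hR hR0) h
  refine ⟨W, ?_, hWn⟩
  have hL : MemLp w ∞ X.absMeasure := memLp_top_of_bound hw R (Eventually.of_forall hR)
  have hker : ∀ n : ℕ, X.IsIntegralOperator ((h ^ (n + 1) / ((n + 1).factorial : ℂ)) •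
      _root_.iterCommutator (mulLp X.absMeasure w)
        (InnerProductSpace.rankOne ℂ (hf.toLp f) (X.dualVec hg)) n)
      fun u v => h ^ (n + 1) / ((n + 1).factorial : ℂ) * ((w u - w v) ^ n * (f u * g v)) :=
    fun n => ((IsIntegralOperator.rankOne hf hg).iterCommutator hL n).smul _
  refine IsIntegralOperator.of_tendsto (fun N => IsIntegralOperator.sum hker N)
    (A := fun u => ‖h‖ * Real.exp (2 * R * ‖h‖) * ‖f u‖) (B := g)
    (fun φ => ?_) (fun u v => ?_) hg fun N u v => ?_
  · have := ((ContinuousLinearMap.apply ℂ X.Hilb φ).hasSum hW).tendsto_sum_nat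
    simpa using this
  · have := ((hasSum_divExp h (w u - w v)).mul_right (f u * g v)).tendsto_sum_nat
    simpa only [mul_assoc] using this
  · simp only [← mul_assoc]
    rw [← Finset.sum_mul, ← Finset.sum_mul, norm_mul, norm_mul]
    gcongr
    refine (norm_sum_le _ _).trans ?_
    have h2 : ∀ n ∈ Finset.range N,
        ‖h ^ (n + 1) / ((n + 1).factorial : ℂ) * (w u - w v) ^ n‖ ≤
        ‖h‖ * ((2 * R * ‖h‖) ^ n / n.factorial) := fun n _ => by
      rw [norm_mul, norm_pow]
      refine le_trans ?_ (norm_pow_succ_div_factorial_mul_le h (by positivity : 0 ≤ 2 * R) n)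
      gcongr
      refine (norm_sub_le _ _).trans ?_
      linarith [hR u, hR v]
    refine (Finset.sum_le_sum h2).trans ?_
    rw [← Finset.mul_sum]
    gcongr
    exact Real.sum_le_exp_of_nonneg (by positivity) N

end SpectralSet

/-! ### Differentiating Fredholm determinants along paths -/

section Derivative

variable {E : Type*} [NormedAddCommGroup E] [InnerProductSpace ℂ E]

theorem mul_rankOne (A : E →L[ℂ] E) (x y : E) :
    A * InnerProductSpace.rankOne ℂ x y = InnerProductSpace.rankOne ℂ (A x) y :=
  InnerProductSpace.comp_rankOne x y A

variable [CompleteSpace E]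

theorem NuclearNormLE.rankOne_sub_rankOne (x x' y y' : E) :
    NuclearNormLE (InnerProductSpace.rankOne ℂ x y - InnerProductSpace.rankOne ℂ x' y')
      (‖x - x'‖ * ‖y‖ + ‖x'‖ * ‖y - y'‖) := by
  have := (NuclearNormLE.rankOne (x - x') y).add (NuclearNormLE.rankOne x' (y - y'))
  rwa [map_sub, map_sub, _root_.sub_apply, sub_add_sub_cancel] at this

/-- Differentiation of a Fredholm determinant along a path whose increments are approximately of
rank one. -/
theorem hasDerivAt_fredholmDet_of_increment {ι : Type*} (b : HilbertBasis ι ℂ E)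
    {D : ℝ → ℂ} {s : ℝ} {T : E →L[ℂ] E} {x y : E} {r : ℝ} (hT : NuclearNormLE T r) {η : ℝ → ℝ}
    (hη : Tendsto η (𝓝 0) (𝓝 0)) (hD : D s = fredholmDet b T)
    (h : ∀ᶠ t in 𝓝 s, ∃ W : E →L[ℂ] E, NuclearNormLE W (|t - s| * η (t - s)) ∧
      D t = fredholmDet b (T + ((t - s : ℝ) : ℂ) • InnerProductSpace.rankOne ℂ x y + W)) :
    HasDerivAt D (fredholmDet b (T + InnerProductSpace.rankOne ℂ x y) - fredholmDet b T) s := by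
  rw [hasDerivAt_iff_isLittleO, Asymptotics.isLittleO_iff]
  intro c hc
  set ρ := ‖x‖ * ‖y‖
  have hlim : Tendsto (fun t => η (t - s) *
      Real.exp (r + |t - s| * ρ + |t - s| * η (t - s) + 1)) (𝓝 s) (𝓝 0) := by
    have h1 : Tendsto (fun t : ℝ => t - s) (𝓝 s) (𝓝 0) := by
      simpa using (continuous_sub_right s).tendsto s
    have h2 := h1.abs
    have h3 := hη.comp h1
    have h4 : Tendsto (fun t => r + |t - s| * ρ + |t - s| * η (t - s) + 1) (𝓝 s)
        (𝓝 (r + |(0 : ℝ)| * ρ + |(0 : ℝ)| * 0 + 1)) :=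
      (((h2.mul_const ρ).const_add r).add (h2.mul h3)).add_const 1
    simpa [Function.comp_def] using h3.mul ((Real.continuous_exp.tendsto _).comp h4)
  filter_upwards [h, hlim.eventually_le_const hc] with t ht htc
  obtain ⟨W, hW, hDt⟩ := ht
  have hR := (NuclearNormLE.rankOne x y).smul ((t - s : ℝ) : ℂ)
  have h1 := norm_fredholmDet_add_sub_le (hT.add hR) hW b
  -- The rank one part contributes exactly the linear term; only `W` is an error.
  rw [← hDt, fredholmDet_add_smul_rankOne hT] at h1
  have h2 : D t - D s - (t - s) • (fredholmDet b (T + InnerProductSpace.rankOne ℂ x y) -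
      fredholmDet b T) = D t - (fredholmDet b T + ((t - s : ℝ) : ℂ) *
      (fredholmDet b (T + InnerProductSpace.rankOne ℂ x y) - fredholmDet b T)) := by
    rw [hD, Complex.real_smul]
    ring
  rw [h2]
  refine h1.trans ?_
  rw [Complex.norm_real, Real.norm_eq_abs, mul_assoc, mul_comm c]
  exact mul_le_mul_of_nonneg_left htc (abs_nonneg _)

/-- Contractions do not increase nuclear norm bounds, so the Lipschitz estimate is uniform in `n`.
-/
theorem eventually_norm_fredholmDet_mul_sub_le {ι : Type*} (b : HilbertBasis ι ℂ E)
    {B : ℝ → E →L[ℂ] E} {s₀ r : ℝ} {P : ℕ → E →L[ℂ] E} (hP : ∀ n, ‖P n‖ ≤ 1)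
    (h₀ : NuclearNormLE (B s₀) r)
    (hB : ∀ ε > 0, ∀ᶠ s in 𝓝 s₀, NuclearNormLE (B s - B s₀) ε) {ε : ℝ} (hε : 0 < ε) :
    ∀ᶠ s in 𝓝 s₀, ∀ n, ‖fredholmDet b (P n * B s) - fredholmDet b (P n * B s₀)‖ ≤ ε := by
  obtain ⟨δ, hδε, hδ⟩ : ∃ δ : ℝ, δ * Real.exp (r + δ + 1) ≤ ε ∧ 0 < δ := by
    have hc : Continuous fun v : ℝ => v * Real.exp (r + v + 1) := by fun_prop
    have h1 : Tendsto (fun v : ℝ => v * Real.exp (r + v + 1)) (𝓝[>] 0) (𝓝 0) := by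
      simpa using (hc.tendsto 0).mono_left nhdsWithin_le_nhds
    exact ((h1.eventually_le_const hε).and self_mem_nhdsWithin).exists
  have hmul : ∀ {T : E →L[ℂ] E} {t : ℝ} (n : ℕ), NuclearNormLE T t → NuclearNormLE (P n * T) t :=
    fun n h => (h.comp_left (P n)).mono (mul_le_of_le_one_left h.nonneg (hP n))
  filter_upwards [hB δ hδ] with s hs n
  have := norm_fredholmDet_add_sub_le (hmul n h₀) (hmul n hs) b
  rw [← mul_add, add_sub_cancel] at this
  exact this.trans hδε

/-- Differentiation of a Fredholm determinant along a path that is continuous in nuclear norm, and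
whose compressions are differentiable with derivatives of rank one. -/
theorem hasDerivAt_fredholmDet_of_compressions {ι : Type*} (b : HilbertBasis ι ℂ E)
    {H : ℝ → E →L[ℂ] E} {x y : ℝ → E} {s₀ : ℝ} {P : ℕ → E →L[ℂ] E} (hP : ∀ n, ‖P n‖ ≤ 1)
    (hPt : ∀ φ, Tendsto (fun n => P n φ) atTop (𝓝 φ))
    (hH : ∀ᶠ s in 𝓝 s₀, ∃ r, NuclearNormLE (H s) r)
    (hHc : ∀ ε > 0, ∀ᶠ s in 𝓝 s₀, NuclearNormLE (H s - H s₀) ε)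
    (hx : ContinuousAt x s₀) (hy : ContinuousAt y s₀)
    (hd : ∀ᶠ s in 𝓝 s₀, ∀ n, HasDerivAt (fun t => fredholmDet b (P n * H t))
      (fredholmDet b (P n * (H s + InnerProductSpace.rankOne ℂ (x s) (y s))) -
        fredholmDet b (P n * H s)) s) :
    HasDerivAt (fun t => fredholmDet b (H t))
      (fredholmDet b (H s₀ + InnerProductSpace.rankOne ℂ (x s₀) (y s₀)) - fredholmDet b (H s₀))
      s₀ := by
  obtain ⟨r, hr⟩ := hH.self_of_nhds
  set B : ℝ → E →L[ℂ] E := fun s => H s + InnerProductSpace.rankOne ℂ (x s) (y s)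
  have hB₀ : NuclearNormLE (B s₀) (r + ‖x s₀‖ * ‖y s₀‖) := hr.add (NuclearNormLE.rankOne _ _)
  have hBc : ∀ ε > 0, ∀ᶠ s in 𝓝 s₀, NuclearNormLE (B s - B s₀) ε := by
    intro ε hε
    have h1 : Tendsto (fun s => ‖x s - x s₀‖ * ‖y s‖ + ‖x s₀‖ * ‖y s - y s₀‖) (𝓝 s₀) (𝓝 0) := by
      have h2 := ((hx.tendsto.sub_const (x s₀)).norm.mul hy.tendsto.norm).add
        ((hy.tendsto.sub_const (y s₀)).norm.const_mul ‖x s₀‖)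
      simpa using h2
    filter_upwards [hHc (ε / 2) (half_pos hε), h1.eventually_le_const (half_pos hε)] with s h3 h4
    have h5 := h3.add ((NuclearNormLE.rankOne_sub_rankOne (x s) (x s₀) (y s) (y s₀)).mono h4)
    rwa [add_halves, ← add_sub_add_comm] at h5
  rw [hasDerivAt_iff_isLittleO, Asymptotics.isLittleO_iff]
  intro c hc
  have hev := (hd.and ((eventually_norm_fredholmDet_mul_sub_le b hP hr hHc (half_pos hc)).and
    (eventually_norm_fredholmDet_mul_sub_le b hP hB₀ hBc (half_pos hc)))).and hH
  obtain ⟨δ, hδ, hball⟩ := Metric.eventually_nhds_iff_ball.mp hev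
  filter_upwards [Metric.ball_mem_nhds s₀ hδ] with t ht
  set φ : ℕ → ℝ → ℂ := fun n s => fredholmDet b (P n * B s) - fredholmDet b (P n * H s)
  -- Here `φ n` is the derivative of the `n`-th compressed determinant. It varies by at most `c` on
  -- a ball that does not depend on `n`, so the mean value inequality survives `n → ∞`.
  have hn : ∀ n, ‖fredholmDet b (P n * H t) - fredholmDet b (P n * H s₀) - (t - s₀) • φ n s₀‖ ≤
      c * ‖t - s₀‖ := by
    intro n
    have hder : ∀ s ∈ Metric.ball s₀ δ,
        HasDerivWithinAt (fun s => fredholmDet b (P n * H s) - s • φ n s₀) (φ n s - φ n s₀)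
          (Metric.ball s₀ δ) s := by
      intro s hs
      have h2 := ((hasDerivAt_id s).smul_const (φ n s₀))
      rw [one_smul] at h2
      exact (((hball s hs).1.1 n).sub h2).hasDerivWithinAt
    have hbd : ∀ s ∈ Metric.ball s₀ δ, ‖φ n s - φ n s₀‖ ≤ c := by
      intro s hs
      have h1 := (hball s hs).1.2.1 n
      have h2 := (hball s hs).1.2.2 n
      calc ‖φ n s - φ n s₀‖ = ‖(fredholmDet b (P n * B s) - fredholmDet b (P n * B s₀)) -
            (fredholmDet b (P n * H s) - fredholmDet b (P n * H s₀))‖ := by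
            congr 1
            simp only [φ]
            ring
        _ ≤ c := (norm_sub_le _ _).trans (by linarith)
    have := (convex_ball s₀ δ).norm_image_sub_le_of_norm_hasDerivWithin_le hder hbd
      (Metric.mem_ball_self hδ) ht
    convert! this using 2
    rw [sub_smul]
    abel
  obtain ⟨rt, hrt⟩ := (hball t ht).2
  have hlim : ∀ {T : E →L[ℂ] E} {r : ℝ}, NuclearNormLE T r →
      Tendsto (fun n => fredholmDet b (P n * T)) atTop (𝓝 (fredholmDet b T)) := fun h =>
    (h.tendsto_mul hP hPt).tendsto_fredholmDet h b
  exact le_of_tendsto ((((hlim hrt).sub (hlim hr)).sub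
    (((hlim hB₀).sub (hlim hr)).const_smul (t - s₀))).norm) (Eventually.of_forall hn)

end Derivative

/-! ### From trace norms to nuclear norms, dual vectors, and disc cut-offs -/

theorem IsTraceClass.exists_nuclearNormLE {E : Type*} [NormedAddCommGroup E]
    [InnerProductSpace ℂ E] {T : E →L[ℂ] E} (h : IsTraceClass T) : ∃ r, NuclearNormLE T r := by
  obtain ⟨a, b, r, h⟩ := h
  exact ⟨r, h.nuclearNormLE⟩

/-- The infimum of the empty set is `0`, so a small `traceNorm` alone says nothing. Interleaving
representations of `T` and `-S` shows that the set is nonempty. -/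
theorem nuclearNormLE_of_traceNorm_lt {E : Type*} [NormedAddCommGroup E]
    [InnerProductSpace ℂ E] [CompleteSpace E] {T S : E →L[ℂ] E} (hT : IsTraceClass T)
    (hS : IsTraceClass S) {ε : ℝ} (h : traceNorm (T - S) < ε) : NuclearNormLE (T - S) ε := by
  have hne : {r : ℝ | ∃ a b : ℕ → E, IsNuclearRep (T - S) a b r}.Nonempty := by
    obtain ⟨a, b, r, h1, h2⟩ := hT
    obtain ⟨a', b', r', h1', h2'⟩ := hS
    have he : ∀ k : ℕ, Even (2 * k) := fun k => even_two_mul k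
    have ho : ∀ k : ℕ, ¬Even (2 * k + 1) := fun k => by simp
    have hd : ∀ k : ℕ, (2 * k + 1) / 2 = k := fun k => by omega
    refine ⟨r + r', fun n => if Even n then a (n / 2) else -a' (n / 2),
      fun n => if Even n then b (n / 2) else b' (n / 2), ?_, fun x => ?_⟩
    · refine HasSum.even_add_odd ?_ ?_
      · simpa [he] using h1
      · simpa [ho, hd] using h1'
    · rw [_root_.sub_apply, sub_eq_add_neg]
      refine HasSum.even_add_odd ?_ ?_
      · simpa [he] using h2 x
      · simpa [ho, hd] using (h2' x).neg
  obtain ⟨r, ⟨a, b, hr⟩, hlt⟩ := exists_lt_of_csInf_lt hne h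
  exact hr.nuclearNormLE.mono hlt.le

namespace SpectralSet

variable (X : SpectralSet)

theorem norm_dualVec_sub_le : ∃ C : ℝ, ∀ (g g' : ℂ → ℂ) (hg : MemLp g 2 X.absMeasure)
    (hg' : MemLp g' 2 X.absMeasure),
    ‖X.dualVec hg - X.dualVec hg'‖ ≤ C * ‖hg.toLp g - hg'.toLp g'‖ := by
  obtain ⟨C, hC⟩ := X.exists_norm_density_le
  refine ⟨C, fun g g' hg hg' => Lp.norm_le_mul_norm_of_ae_le_mul ?_⟩
  have h := (X.memLp_density.mul hg : MemLp (fun u => g u * X.density u) 2 X.absMeasure).star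
  have h' := (X.memLp_density.mul hg' : MemLp (fun u => g' u * X.density u) 2 X.absMeasure).star
  filter_upwards [Lp.coeFn_sub (X.dualVec hg) (X.dualVec hg'),
    Lp.coeFn_sub (hg.toLp g) (hg'.toLp g'), hg.coeFn_toLp, hg'.coeFn_toLp, h.coeFn_toLp,
    h'.coeFn_toLp] with u h1 h2 h3 h4 h5 h6
  rw [h1, h2, Pi.sub_apply, Pi.sub_apply, h3, h4, dualVec, dualVec, h5, h6]
  simp only [Pi.star_apply]
  rw [← star_sub, norm_star, Pi.mul_apply, Pi.mul_apply, ← sub_mul, norm_mul, mul_comm]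
  exact mul_le_mul_of_nonneg_right (hC u) (norm_nonneg _)

theorem norm_toLp_sub_toLp {X : SpectralSet} {f f' : ℂ → ℂ} (hf : MemLp f 2 X.absMeasure)
    (hf' : MemLp f' 2 X.absMeasure) :
    ‖hf.toLp f - hf'.toLp f'‖ = (eLpNorm (fun u => f u - f' u) 2 X.absMeasure).toReal := by
  rw [← MemLp.toLp_sub, Lp.norm_toLp]
  rfl

end SpectralSet

/-- The cut-off function of the disc `|z| ≤ n`. -/
def discCutoff (n : ℕ) (z : ℂ) : ℂ := Set.indicator {z : ℂ | ‖z‖ ≤ n} 1 z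

theorem measurable_discCutoff (n : ℕ) : Measurable (discCutoff n) :=
  measurable_const.indicator (measurableSet_le measurable_norm measurable_const)

theorem norm_discCutoff_le (n : ℕ) (z : ℂ) : ‖discCutoff n z‖ ≤ 1 := by
  rw [discCutoff, Set.indicator_apply]
  split_ifs <;> simp

theorem discCutoff_eq_zero_or_one (n : ℕ) (z : ℂ) : discCutoff n z = 0 ∨ discCutoff n z = 1 := by
  rw [discCutoff, Set.indicator_apply]
  split_ifs <;> simp

theorem norm_discCutoff_mul_le (n : ℕ) (z : ℂ) : ‖discCutoff n z * z‖ ≤ n := by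
  rw [discCutoff, Set.indicator_apply]
  split_ifs with h
  · simpa using h
  · simp

theorem tendsto_discCutoff (z : ℂ) : Tendsto (fun n => discCutoff n z) atTop (𝓝 1) := by
  refine tendsto_const_nhds.congr' ?_
  filter_upwards [tendsto_natCast_atTop_atTop.eventually_ge_atTop ‖z‖] with n h1
  rw [discCutoff, Set.indicator_of_mem]
  · rfl
  · exact h1

/-! ### How the cubic kernel changes with `xᵢ` -/

namespace CubicIntegrableOperator

variable {X : SpectralSet} {m : ℕ} {U : Set (Params m)} (K : CubicIntegrableOperator X m U)

/-- The diagonal of the matrix `Δ`. -/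
def deltaDiag (p : Params m) (z : ℂ) : Fin (m + 1) → ℂ :=
  Fin.snoc (α := fun _ => ℂ) (fun j : Fin m => cubicExp p j z) 1

theorem deltaDiag_ne_zero (p : Params m) (z : ℂ) (j : Fin (m + 1)) : deltaDiag p z j ≠ 0 := by
  refine Fin.lastCases ?_ (fun j => ?_) j
  · simp [deltaDiag]
  · simp [deltaDiag, cubicExp, Complex.exp_ne_zero]

theorem f_apply (p : Params m) (u : ℂ) (j : Fin (m + 1)) :
    K.f p u j = K.c p u * (deltaDiag p u j * K.F u j) := by
  simp [f, cubicVecLeft, deltaMatrix, deltaDiag, Matrix.mulVec_diagonal]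

theorem g_apply (p : Params m) (u : ℂ) (j : Fin (m + 1)) :
    K.g p u j = (K.c p u)⁻¹ * ((deltaDiag p u j)⁻¹ * K.G u j) := by
  have h : (deltaMatrix p u)⁻¹ = Matrix.diagonal (fun j => (deltaDiag p u j)⁻¹) := by
    refine Matrix.inv_eq_right_inv ?_
    rw [deltaMatrix, Matrix.diagonal_mul_diagonal, ← Matrix.diagonal_one]
    congr 1
    ext j
    exact mul_inv_cancel₀ (deltaDiag_ne_zero p u j)
  simp [g, cubicVecRight, h, Matrix.mulVec_diagonal]

/-- This makes the added divided exponential kernel vanish at `u = v`, in agreement with the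
prescribed zero diagonal. -/
theorem f_mul_g_eq_zero (p : Params m) {u : ℂ} (hu : u ∈ X.carrier) (j : Fin (m + 1)) :
    K.f p u j * K.g p u j = 0 := by
  have h : K.F u j * K.G u j = 0 := by
    simpa [unitMatrix, Matrix.single_mulVec, dotProduct, Function.update_apply] using
      K.orthogonal u hu j
  rw [f_apply, g_apply]
  linear_combination (K.c p u * deltaDiag p u j * (K.c p u)⁻¹ * (deltaDiag p u j)⁻¹) * h

theorem deltaDiag_update (p : Params m) (i : Fin m) (t : ℝ) (z : ℂ) (j : Fin (m + 1)) :
    deltaDiag (Function.update p.1 i t, p.2.1, p.2.2) z j =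
      (if j = i.castSucc then Complex.exp (((t - p.1 i : ℝ) : ℂ) * z) else 1) *
        deltaDiag p z j := by
  refine Fin.lastCases ?_ (fun j => ?_) j
  · simp [deltaDiag, (Fin.castSucc_lt_last i).ne']
  · rcases eq_or_ne j i with rfl | h
    · simp only [deltaDiag, Fin.snoc_castSucc, cubicExp, if_true, Function.update_self,
        ← Complex.exp_add]
      congr 1
      push_cast
      ring
    · simp [deltaDiag, cubicExp, h]

/-- Only the `i`-th summand of `f(u)ᵀ g(v)` acquires a factor beyond the ratios of `c`. Splitting
`exp (h (u - v))` as `1` plus a remainder that is divisible by `u - v` removes the singularity from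
the new term. -/
theorem integrableKernel_update {p : Params m} (hp : p ∈ U) (i : Fin m) (t : ℝ)
    (hp' : (Function.update p.1 i t, p.2.1, p.2.2) ∈ U) {u v : ℂ} (hu : u ∈ X.carrier)
    (hv : v ∈ X.carrier) :
    integrableKernel (K.f (Function.update p.1 i t, p.2.1, p.2.2))
        (K.g (Function.update p.1 i t, p.2.1, p.2.2)) u v =
      K.c (Function.update p.1 i t, p.2.1, p.2.2) u / K.c p u *
        (integrableKernel (K.f p) (K.g p) u v + divExp ((t - p.1 i : ℝ) : ℂ) (u - v) *
          (K.f p u i.castSucc * K.g p v i.castSucc)) *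
        (K.c (Function.update p.1 i t, p.2.1, p.2.2) v / K.c p v)⁻¹ := by
  set p' : Params m := (Function.update p.1 i t, p.2.1, p.2.2) with hp'_def
  set h : ℂ := ((t - p.1 i : ℝ) : ℂ)
  rcases eq_or_ne u v with rfl | huv
  · simp [integrableKernel, K.f_mul_g_eq_zero p hu]
  · have hc := K.c_ne_zero p hp
    have hc' := K.c_ne_zero p' hp'
    have huv' : u - v ≠ 0 := sub_ne_zero.mpr huv
    have hterm : ∀ j, K.f p' u j * K.g p' v j = K.c p' u / K.c p u * (K.c p' v / K.c p v)⁻¹ *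
        (K.f p u j * K.g p v j + if j = i.castSucc then
          (Complex.exp (h * (u - v)) - 1) * (K.f p u j * K.g p v j) else 0) := by
      intro j
      simp only [f_apply, g_apply, hp'_def, deltaDiag_update]
      rw [← hp'_def]
      change _ * ((if _ then Complex.exp (h * u) else _) * _ * _) *
        (_ * (((if _ then Complex.exp (h * v) else _) * _)⁻¹ * _)) = _
      have h1 := hc u hu
      have h2 := hc v hv
      have h3 := hc' u hu
      have h4 := hc' v hv
      have h5 := deltaDiag_ne_zero p v j
      split_ifs with hj
      · rw [mul_sub, Complex.exp_sub]
        have h6 := Complex.exp_ne_zero (h * v)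
        field_simp
        ring_nf
      · field_simp
        ring
    rw [integrableKernel, integrableKernel, if_neg huv, if_neg huv, divExp, if_neg huv',
      dotProduct, Finset.sum_congr rfl fun j _ => hterm j, ← Finset.mul_sum,
      Finset.sum_add_distrib, Finset.sum_ite_eq' Finset.univ i.castSucc, if_pos (Finset.mem_univ _),
      dotProduct]
    ring

/-- The compressions of `H` to discs, in the direction of `xᵢ`, have increments that are
approximately of rank one. -/
theorem exists_fredholmDet_increment {p : Params m} (hp : p ∈ U)
    (hTrace : ∀ p ∈ U, IsTraceClass (K.H p)) (i : Fin m) (t : ℝ)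
    (hp' : (Function.update p.1 i t, p.2.1, p.2.2) ∈ U) {ι : Type*} (b : HilbertBasis ι ℂ X.Hilb)
    (n : ℕ) : ∃ W : X.Hilb →L[ℂ] X.Hilb,
      NuclearNormLE W (|t - p.1 i| * ((Real.exp (2 * n * |t - p.1 i|) - 1) *
        (‖K.fL2 hp i.castSucc‖ * ‖X.dualVec (K.g_memLp p hp i.castSucc)‖))) ∧
      fredholmDet b (mulLp X.absMeasure (discCutoff n) *
          K.H (Function.update p.1 i t, p.2.1, p.2.2)) =
        fredholmDet b (mulLp X.absMeasure (discCutoff n) * K.H p +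
          ((t - p.1 i : ℝ) : ℂ) • InnerProductSpace.rankOne ℂ
            (mulLp X.absMeasure (discCutoff n) (K.fL2 hp i.castSucc))
            (X.dualVec (K.g_memLp p hp i.castSucc)) + W) := by
  set p' : Params m := (Function.update p.1 i t, p.2.1, p.2.2) with hp'_def
  set h : ℂ := ((t - p.1 i : ℝ) : ℂ) with hh
  set P := mulLp X.absMeasure (discCutoff n) with hPdef
  have hm : AEStronglyMeasurable (discCutoff n) X.absMeasure :=
    (measurable_discCutoff n).aestronglyMeasurable
  have hP : MemLp (discCutoff n) ∞ X.absMeasure :=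
    memLp_top_of_bound hm 1 (Eventually.of_forall (norm_discCutoff_le n))
  have hPn : ‖P‖ ≤ 1 := norm_mulLp_le hm (norm_discCutoff_le n) zero_le_one
  have hPP : P * P = P := by
    rw [hPdef, mulLp_mul_mulLp hP hP]
    congr 1
    ext z
    rcases discCutoff_eq_zero_or_one n z with hz | hz <;> simp [hz]
  -- The function `discCutoff n * id` is bounded by `n` and equals `z` on the disc, so `V` has the
  -- required kernel wherever the compression sees it.
  obtain ⟨V, hV, hVn⟩ := SpectralSet.exists_isIntegralOperator_divExp (K.f_memLp p hp i.castSucc)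
    (K.g_memLp p hp i.castSucc) (hm.mul measurable_id.aestronglyMeasurable)
    (norm_discCutoff_mul_le n) h
  set Q := InnerProductSpace.rankOne ℂ (K.fL2 hp i.castSucc)
    (X.dualVec (K.g_memLp p hp i.castSucc)) with hQ
  obtain ⟨r, hr⟩ := (hTrace p hp).exists_nuclearNormLE
  obtain ⟨r', hr'⟩ := (hTrace p' hp').exists_nuclearNormLE
  obtain ⟨v, hVr⟩ : ∃ v, NuclearNormLE V v := by
    have := hVn.add ((NuclearNormLE.rankOne (K.fL2 hp i.castSucc)
      (X.dualVec (K.g_memLp p hp i.castSucc))).smul h)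
    rw [fL2] at this
    exact ⟨_, by simpa only [sub_add_cancel] using this⟩
  -- By cyclicity and `P * P = P`, one-sided compressions have the same determinants as the
  -- two-sided ones, whose kernels can be compared.
  have hcut : ∀ {T : X.Hilb →L[ℂ] X.Hilb} {r : ℝ}, NuclearNormLE T r →
      fredholmDet b (P * T * P) = fredholmDet b (P * T) := fun hT => by
    rw [fredholmDet_mul_comm (hT.comp_left P), ← mul_assoc, hPP]
  have hkey : fredholmDet b (P * (K.H p + V) * P) = fredholmDet b (P * K.H p' * P) := by
    refine SpectralSet.fredholmDet_eq_of_kernel_conj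
      ((((K.H_kernel p hp).add hV).mulLp_mul hP).mul_mulLp hP)
      (((K.H_kernel p' hp').mulLp_mul hP).mul_mulLp hP)
      (((hr.add hVr).comp_left P).comp_right P) ((hr'.comp_left P).comp_right P)
      (c := fun u => K.c p' u / K.c p u)
      ((K.c_measurable p' hp').aemeasurable.div
        (K.c_measurable p hp).aemeasurable).aestronglyMeasurable
      (fun u hu => div_ne_zero (K.c_ne_zero p' hp' u hu) (K.c_ne_zero p hp u hu))
      (fun u hu v hv => ?_) b
    have hk := K.integrableKernel_update hp i t hp' hu hv
    rw [← hp'_def, ← hh] at hk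
    rcases discCutoff_eq_zero_or_one n u with hzu | hzu
    · simp [hzu]
    rcases discCutoff_eq_zero_or_one n v with hzv | hzv
    · simp [hzv]
    · have h1 : (discCutoff n * id : ℂ → ℂ) u - (discCutoff n * id : ℂ → ℂ) v = u - v := by
        simp [hzu, hzv]
      simp only [hzu, hzv, one_mul, mul_one, h1]
      exact hk
  refine ⟨P * (V - h • Q), ?_, ?_⟩
  · rw [hh, Complex.norm_real, Real.norm_eq_abs, mul_assoc |t - p.1 i|] at hVn
    exact (hVn.comp_left P).mono (mul_le_of_le_one_left hVn.nonneg hPn)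
  · rw [← hcut hr', ← hkey, hcut (hr.add hVr)]
    congr 1
    rw [← mul_rankOne, ← hQ, mul_sub, mul_smul_comm, mul_add]
    abel

end CubicIntegrableOperator

/-! ### The derivative of the determinant and the matrix `Y₁` -/

namespace CubicIntegrableOperator

variable {X : SpectralSet} {m : ℕ} {U : Set (Params m)} (K : CubicIntegrableOperator X m U)

open Classical in
/-- The component `f_j` in `L²(Ω)`, and `0` for parameters outside `U`. -/
def leftVec (j : Fin (m + 1)) (p : Params m) : X.Hilb :=
  if hp : p ∈ U then K.fL2 hp j else 0

open Classical in
/-- The vector in `L²(Ω)` that represents `φ ↦ ∫ φ g_j dμ`, and `0` for parameters outside `U`. -/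
def rightVec (j : Fin (m + 1)) (p : Params m) : X.Hilb :=
  if hp : p ∈ U then X.dualVec (K.g_memLp p hp j) else 0

theorem leftVec_of_mem (j : Fin (m + 1)) {p : Params m} (hp : p ∈ U) :
    K.leftVec j p = K.fL2 hp j := dif_pos hp

theorem rightVec_of_mem (j : Fin (m + 1)) {p : Params m} (hp : p ∈ U) :
    K.rightVec j p = X.dualVec (K.g_memLp p hp j) := dif_pos hp

variable {K}

theorem continuousAt_leftVec (hU : IsOpen U) (hCont : K.ContinuousDependence) {p : Params m}
    (hp : p ∈ U) (j : Fin (m + 1)) : ContinuousAt (K.leftVec j) p := by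
  rw [ContinuousAt, tendsto_iff_norm_sub_tendsto_zero]
  have h1 := (hCont p hp).1 j
  rw [hU.nhdsWithin_eq hp] at h1
  have h2 := (ENNReal.tendsto_toReal ENNReal.zero_ne_top).comp h1
  refine Tendsto.congr' ?_ h2
  filter_upwards [hU.mem_nhds hp] with q hq
  rw [leftVec_of_mem K j hq, leftVec_of_mem K j hp]
  exact (SpectralSet.norm_toLp_sub_toLp (K.f_memLp q hq j) (K.f_memLp p hp j)).symm

theorem continuousAt_rightVec (hU : IsOpen U) (hCont : K.ContinuousDependence) {p : Params m}
    (hp : p ∈ U) (j : Fin (m + 1)) : ContinuousAt (K.rightVec j) p := by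
  rw [ContinuousAt, tendsto_iff_norm_sub_tendsto_zero]
  have h1 := (hCont p hp).2.1 j
  rw [hU.nhdsWithin_eq hp] at h1
  have h2 := (ENNReal.tendsto_toReal ENNReal.zero_ne_top).comp h1
  obtain ⟨C, hC⟩ := X.norm_dualVec_sub_le
  refine squeeze_zero' (Eventually.of_forall fun _ => norm_nonneg _) ?_
    (by simpa using h2.const_mul C)
  filter_upwards [hU.mem_nhds hp] with q hq
  rw [rightVec_of_mem K j hq, rightVec_of_mem K j hp]
  refine (hC _ _ (K.g_memLp q hq j) (K.g_memLp p hp j)).trans_eq ?_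
  rw [SpectralSet.norm_toLp_sub_toLp]
  rfl

theorem eventually_nuclearNormLE_sub (hU : IsOpen U) (hTrace : ∀ p ∈ U, IsTraceClass (K.H p))
    (hCont : K.ContinuousDependence) {p : Params m} (hp : p ∈ U) {ε : ℝ} (hε : 0 < ε) :
    ∀ᶠ q in 𝓝 p, NuclearNormLE (K.H q - K.H p) ε := by
  have h1 := (hCont p hp).2.2
  rw [hU.nhdsWithin_eq hp] at h1
  filter_upwards [hU.mem_nhds hp, h1.eventually_lt_const hε] with q hq hlt
  exact nuclearNormLE_of_traceNorm_lt (hTrace q hq) (hTrace p hp) hlt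

theorem hasDerivAt_fredholmDet (hU : IsOpen U) (hTrace : ∀ p ∈ U, IsTraceClass (K.H p))
    (hCont : K.ContinuousDependence) {p : Params m} (hp : p ∈ U) {ι : Type*}
    (b : HilbertBasis ι ℂ X.Hilb) (i : Fin m) :
    HasDerivAt (fun s : ℝ => fredholmDet b (K.H (Function.update p.1 i s, p.2.1, p.2.2)))
      (fredholmDet b (K.H p + InnerProductSpace.rankOne ℂ (K.leftVec i.castSucc p)
        (K.rightVec i.castSucc p)) - fredholmDet b (K.H p)) (p.1 i) := by
  set q : ℝ → Params m := fun s => (Function.update p.1 i s, p.2.1, p.2.2) with hq_def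
  have hq₀ : q (p.1 i) = p := by simp [q]
  have hqc : Continuous q := by
    refine Continuous.prodMk (continuous_const.update i continuous_id) continuous_const
  have hqt : Tendsto q (𝓝 (p.1 i)) (𝓝 p) := by
    simpa only [hq₀] using hqc.tendsto (p.1 i)
  have hqU : ∀ᶠ s in 𝓝 (p.1 i), q s ∈ U := hqt.eventually (hU.mem_nhds hp)
  have hm : ∀ n, AEStronglyMeasurable (discCutoff n) X.absMeasure := fun n =>
    (measurable_discCutoff n).aestronglyMeasurable
  have key := hasDerivAt_fredholmDet_of_compressions b (H := fun s => K.H (q s))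
    (x := fun s => K.leftVec i.castSucc (q s)) (y := fun s => K.rightVec i.castSucc (q s))
    (s₀ := p.1 i) (P := fun n => mulLp X.absMeasure (discCutoff n))
    (fun n => norm_mulLp_le (hm n) (norm_discCutoff_le n) zero_le_one)
    (fun φ => tendsto_mulLp hm norm_discCutoff_le (Eventually.of_forall tendsto_discCutoff) φ)
    (hqU.mono fun s hs => (hTrace _ hs).exists_nuclearNormLE)
    (fun ε hε => by
      simp only [hq₀]
      exact hqt.eventually (eventually_nuclearNormLE_sub hU hTrace hCont hp hε))
    ((continuousAt_leftVec hU hCont hp _).comp_of_eq hqc.continuousAt hq₀)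
    ((continuousAt_rightVec hU hCont hp _).comp_of_eq hqc.continuousAt hq₀)
    ?_
  · simpa only [hq₀] using key
  -- The mean value argument needs the derivative at all nearby `s`, so increments are taken from
  -- the base point `q s` rather than from `p`.
  · filter_upwards [hqU.eventually_nhds] with s hs n
    have hsU : q s ∈ U := hs.self_of_nhds
    obtain ⟨r, hr⟩ := (hTrace _ hsU).exists_nuclearNormLE
    rw [mul_add, mul_rankOne]
    set M := ‖K.fL2 hsU i.castSucc‖ * ‖X.dualVec (K.g_memLp (q s) hsU i.castSucc)‖
    refine hasDerivAt_fredholmDet_of_increment b (hr.comp_left _)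
      -- This is the second order remainder on the disc of radius `n`; it is not uniform in `n`,
      -- which is why the compressions are differentiated one at a time.
      (η := fun h => (Real.exp (2 * n * |h|) - 1) * M) ?_ rfl ?_
    · have : Continuous fun h : ℝ => (Real.exp (2 * n * |h|) - 1) * M := by fun_prop
      simpa using this.tendsto 0
    · filter_upwards [hs] with t ht
      have hqst : (Function.update (q s).1 i t, (q s).2.1, (q s).2.2) = q t := by simp [q]
      have hsi : (q s).1 i = s := by simp [q]
      have := K.exists_fredholmDet_increment hsU hTrace i t (by rwa [hqst]) b n
      rw [hqst, hsi] at this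
      rw [leftVec_of_mem K _ hsU, rightVec_of_mem K _ hsU]
      exact this

/-- The conjugation built into `dualVec` turns the inner product into the bilinear integral that
defines the diagonal entry of `Y₁`. -/
theorem inner_rightVec_inverse {p : Params m} (hp : p ∈ U) (j : Fin (m + 1)) :
    inner ℂ (K.rightVec j p) (Ring.inverse (1 - K.H p) (K.leftVec j p)) =
      Matrix.trace (K.Y₁ hp * unitMatrix j) := by
  rw [leftVec_of_mem K j hp, rightVec_of_mem K j hp, X.inner_dualVec, unitMatrix,
    Matrix.trace_mul_single, Y₁, Matrix.of_apply, MulOpposite.op_one, one_smul]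
  exact congrArg X.integral (funext fun v => mul_comm _ _)

end CubicIntegrableOperator

theorem mainTheorem7 (X : SpectralSet) (m : ℕ) (U : Set (Params m)) (hU : IsOpen U)
    (K : CubicIntegrableOperator X m U)
    (hTrace : ∀ p ∈ U, IsTraceClass (K.H p))
    (hCont : K.ContinuousDependence)
    (p : Params m) (hp : p ∈ U) (hInv : IsUnit (1 - K.H p))
    {ι : Type*} (b : HilbertBasis ι ℂ X.Hilb) (i : Fin m) :
    fredholmDet b (K.H p) ≠ 0 ∧
    DifferentiableAt ℝ
      (fun s : ℝ => fredholmDet b (K.H (Function.update p.1 i s, p.2.1, p.2.2))) (p.1 i) ∧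
    logDeriv
      (fun s : ℝ => fredholmDet b (K.H (Function.update p.1 i s, p.2.1, p.2.2))) (p.1 i) =
      -Matrix.trace (K.Y₁ hp * unitMatrix i.castSucc) := by
  obtain ⟨r, hr⟩ := (hTrace p hp).exists_nuclearNormLE
  have hne := fredholmDet_ne_zero hr hInv b
  have hder := CubicIntegrableOperator.hasDerivAt_fredholmDet hU hTrace hCont hp b i
  refine ⟨hne, hder.differentiableAt, ?_⟩
  rw [logDeriv_apply, hder.deriv, fredholmDet_add_rankOne hr hInv,
    CubicIntegrableOperator.inner_rightVec_inverse hp]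
  simp only [Function.update_eq_self, Prod.mk.eta]
  field_simp
  ring

end
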